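/- \textbf{Model.} Time is slotted, $t\in\{0,1,2,\dots\}$. On slot $t$ a network has a state $z(t)$ in a countable set $\mathcal Z$ containing a state $0$, with $z(0)=0$; a random outcome $\Omega(t)=(\omega(t),\phi(t))$, i.i.d. over slots and independent of the past and of $z(t)$, with $\phi(t)\in\{0,1\}$ independent of $\omega(t)$ and $\Pr[\phi(t)=1]=\phi>0$; and a control action $I(t)\in\mathcal I_{\Omega(t),z(t)}$, chosen (possibly at random) from the history and the current $\Omega(t),z(t)$. Given the history up to and including $I(t)$, the next state has law $P_{z(t),\cdot}(I(t),\Omega(t))$, and $\phi(t)=1$ forces $z(t+1)=0$. A $(z,\Omega)$-only policy chooses $I(t)$ by a fixed randomized rule from $(z(t),\Omega(t))$ alone. There are finitely many queues $n\in\mathcal N$ and penalties $m\in\{0,\dots,M\}$; put $\mathcal M=\{1,\dots,M\}$. The service $\mu_n(t)=\hat\mu_n(I(t),\Omega(t),z(t))$, the arrivals $R_n(t)=\hat R_n(I(t),\Omega(t),z(t))$ and the penalties $x_m(t)=\hat x_m(I(t),\Omega(t),z(t))$ are given by bounded functions, $\hat\mu_n,\hat R_n\ge0$; put $d_n=\mu_n-R_n$.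 For given reals $x_m^{av}$, $m\in\mathcal M$, the actual and virtual queues start at $0$ and satisfy $$Q_n(t+1)=\max[Q_n(t)-\mu_n(t),0]+R_n(t),\qquad Y_m(t+1)=\max[Y_m(t)-x_m^{av}+x_m(t),0].$$ Let $\Theta(t)$ be the vector of all $Q_n(t)$ and $Y_m(t)$. \textbf{Renewals.} Slot $0$ is a renewal, and a slot $t>0$ is a renewal if $z(t)=0$ and the history before $t$ satisfies a given criterion. Let $t_0=0<t_1<t_2<\cdots$ be the renewals and $T_g=t_{g+1}-t_g$. It is required that (i) there are finite $m_1,m_2$ such that under every policy the first and second moments of the time from a renewal to the next one are at most $m_1$ and $m_2$, regardless of the past history; (ii) under every $(z,\Omega)$-only policy, the lengths of the renewal intervals, together with the sequences of decisions and penalties in them, are i.i.d. over the intervals. For type-1 renewals the criterion is empty (every visit to $0$ is a renewal); for type-2 renewals it is $\phi(t-1)=1$. \textbf{Constants and shortest paths.} For a policy and a renewal time $t_g$ put $$D(\Theta(t_g))=-\sum_{n\in\mathcal N} Q_n(t_g)\,\mathbb E\Big[\sum_{\tau=0}^{T_g-1} d_n(t_g+\tau)\,\Big|\,\Theta(t_g)\Big]-\sum_{m\in\mathcal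 M} Y_m(t_g)\,\mathbb E\Big[T_gx_m^{av}-\sum_{\tau=0}^{T_g-1}x_m(t_g+\tau)\,\Big|\,\Theta(t_g)\Big].$$ For a backlog vector $\Theta$ with entries $Q_n,Y_m$, let $D^{ssp}(\Theta)$ be the infimum, over all policies for a renewal interval that starts at slot $0$ in state $0$ and has length $T$, of $-\sum_n Q_n\mathbb E[\sum_{\tau<T}d_n(\tau)]-\sum_m Y_m\mathbb E[Tx_m^{av}-\sum_{\tau<T}x_m(\tau)]$. Let $\sigma^2$ be a constant with $\sum_n[\mu_n(t)^2+R_n(t)^2]+\sum_{m\in\mathcal M}(x_m(t)-x_m^{av})^2\le\sigma^2$ for all $t$ under the implemented policy, and let $B=\frac{\sigma^2}{2}\sup\mathbb E[T_g^2\mid\Theta(t_g)]$ for that policy, where the supremum is over all $g$ and (essentially) over all values of $\Theta(t_g)$. \textbf{Theorem (Performance for Feasibility Problems).} Suppose that, for some $\epsilon>0$, there is a $(z,\Omega)$-only policy $I^*$ such that, with $T^*$ its first renewal time and $x_m^*,d_n^*$ the corresponding quantities under $I^*$, $$\frac{\mathbb E[\sum_{\tau=0}^{T^*-1}x_m^*(\tau)]}{\mathbb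 E[T^*]}\le x_m^{av}-\epsilon\quad(m\in\mathcal M),\qquad \frac{\mathbb E[\sum_{\tau=0}^{T^*-1}d_n^*(\tau)]}{\mathbb E[T^*]}\ge\epsilon\quad(n\in\mathcal N).$$ Suppose that there are constants $C\ge0$ and $\delta\ge0$ with $\delta<\epsilon\,\mathbb E[T^*]$ such that the implemented policy satisfies, almost surely at every renewal time $t_g$, $$D(\Theta(t_g))\le D^{ssp}(\Theta(t_g))+C+\delta\sum_{n\in\mathcal N}Q_n(t_g)+\delta\sum_{m\in\mathcal M}Y_m(t_g).$$ Then: \begin{enumerate} \item all queues are strongly stable: $\limsup_{t\to\infty}\frac1t\sum_{\tau=0}^{t-1}\mathbb E[Q_n(\tau)]<\infty$ and $\limsup_{t\to\infty}\frac1t\sum_{\tau=0}^{t-1}\mathbb E[Y_m(\tau)]<\infty$ for all $n\in\mathcal N$, $m\in\mathcal M$; \item the time average constraints hold: $\limsup_{t\to\infty}\frac1t\sum_{\tau=0}^{t-1}\mathbb E[x_m(\tau)]\le x_m^{av}$ for all $m\in\mathcal M$; \item the backlogs at the renewal times are integrable, and for every integer $G>0$, $$\frac1G\sum_{g=0}^{G-1}\Big[\sum_{n\in\mathcal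 N}\mathbb E[Q_n(t_g)]+\sum_{m\in\mathcal M}\mathbb E[Y_m(t_g)]\Big]\le\frac{B+C}{\epsilon\,\mathbb E[T^*]-\delta};$$ \item $1\le\mathbb E[T^*]\le1/\phi$ for type-1 renewals, and $\mathbb E[T^*]=1/\phi$ for type-2 renewals. \end{enumerate} -/

import Mathlib

open MeasureTheory ProbabilityTheory Filter
open scoped ENNReal NNReal

noncomputable section

/-- What happens in one slot `t`: the network state `z(t)`, the random outcome
`Ω(t) = (ω(t), φ(t))`, where `φ(t) = true` means a forced renewal, and the control action `I(t)`. -/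
abbrev Slot (Z W A : Type*) := (Z × (W × Bool)) × A

/-- A sample path of the system. -/
abbrev SamplePath (Z W A : Type*) := ℕ → Slot Z W A

/-- The history before slot `t`. -/
def past {Z W A : Type*} (t : ℕ) (path : SamplePath Z W A) : Fin t → Slot Z W A := fun i => path i

/-- A stochastic queueing network with queues `N`, a controlled Markov state in `Z`, outcomes in
`W × Bool`, control actions in `A`, penalties `x₀, …, x_M` and forced renewals.
The action sets are `𝓘_{Ω, z} = actions (z, Ω)`. -/
structure Network (N Z W A : Type*) (M : ℕ)
    [MeasurableSpace Z] [MeasurableSpace W] [MeasurableSpace A] where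
  /-- the renewal state `0` -/
  zero : Z
  /-- the law of `ω(t)` -/
  law : Measure W
  law_prob : IsProbabilityMeasure law
  /-- the forced renewal probability -/
  phi : unitInterval
  phi_pos : 0 < phi
  /-- the sets of available actions -/
  actions : Z × (W × Bool) → Set A
  measurableSet_actions : MeasurableSet {s : Slot Z W A | s.2 ∈ actions s.1}
  /-- the conditional law of `z(t+1)` given `z(t)`, `Ω(t)` and `I(t)` -/
  trans : Kernel (Slot Z W A) Z
  trans_markov : IsMarkovKernel trans
  forced : ∀ (y : Z) (w : W), ∀ a ∈ actions (y, (w, true)),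
    trans ((y, (w, true)), a) = Measure.dirac zero
  /-- the service functions `μ̂_n` -/
  service : N → Slot Z W A → ℝ
  serviceMax : N → ℝ
  measurable_service : ∀ n, Measurable (service n)
  service_bound : ∀ n s, s.2 ∈ actions s.1 → 0 ≤ service n s ∧ service n s ≤ serviceMax n
  /-- the arrival functions `R̂_n` -/
  arrival : N → Slot Z W A → ℝ
  arrivalMax : N → ℝ
  measurable_arrival : ∀ n, Measurable (arrival n)
  arrival_bound : ∀ n s, s.2 ∈ actions s.1 → 0 ≤ arrival n s ∧ arrival n s ≤ arrivalMax n
  /-- the penalty functions `x̂_0, …, x̂_M` -/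
  penalty : Fin (M + 1) → Slot Z W A → ℝ
  penaltyMin : Fin (M + 1) → ℝ
  penaltyMax : Fin (M + 1) → ℝ
  measurable_penalty : ∀ m, Measurable (penalty m)
  penalty_bound : ∀ m s, s.2 ∈ actions s.1 →
    penaltyMin m ≤ penalty m s ∧ penalty m s ≤ penaltyMax m
  /-- the required bounds `x_m^av` on the time averages of `x_1, …, x_M`; the bound with index
  `m : Fin M` belongs to the penalty with index `m.succ` -/
  target : Fin M → ℝ

/-- A definition of renewals: slot `0` is one, and a slot `t > 0` is one if `z(t) = 0` and the
history before `t` lies in `criterion t`. -/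
structure RenewalRule (Z W A : Type*)
    [MeasurableSpace Z] [MeasurableSpace W] [MeasurableSpace A] where
  criterion : (t : ℕ) → Set (Fin t → Slot Z W A)
  measurableSet_criterion : ∀ t, MeasurableSet (criterion t)

namespace RenewalRule

variable {Z W A : Type*} [MeasurableSpace Z] [MeasurableSpace W] [MeasurableSpace A]

/-- Type-1 renewals: all the visits to state `0`. -/
def typeOne : RenewalRule Z W A where
  criterion _ := Set.univ
  measurableSet_criterion _ := MeasurableSet.univ

/-- Type-2 renewals: a slot is a renewal if the slot before had a forced renewal. -/
def typeTwo : RenewalRule Z W A where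
  criterion t := {h | ∃ i : Fin t, (i : ℕ) + 1 = t ∧ (h i).1.2.2 = true}
  measurableSet_criterion t := by
    have h : {h : Fin t → Slot Z W A | ∃ i : Fin t, (i : ℕ) + 1 = t ∧ (h i).1.2.2 = true}
        = ⋃ i : Fin t, {h | (i : ℕ) + 1 = t ∧ (h i).1.2.2 = true} := by
      ext; simp
    rw [h]
    refine MeasurableSet.iUnion fun i => ?_
    refine (MeasurableSet.const _).inter ?_
    exact measurableSet_eq_fun (by fun_prop) (by fun_prop)

end RenewalRule

namespace Network

variable {N Z W A : Type*} {M : ℕ}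
  [MeasurableSpace Z] [MeasurableSpace W] [MeasurableSpace A]

/-- The law of the random outcome `Ω(t) = (ω(t), φ(t))`, with `φ(t)` independent of `ω(t)`. -/
def outcomeLaw (S : Network N Z W A M) : Measure (W × Bool) :=
  S.law.prod (bernoulliMeasure true false S.phi)

/-- A control policy: a randomized choice of `I(t)`, given the history before slot `t` and the
current `(z(t), Ω(t))`. -/
structure Policy (S : Network N Z W A M) where
  choose : (t : ℕ) → Kernel ((Fin t → Slot Z W A) × (Z × (W × Bool))) A
  markov : ∀ t, IsMarkovKernel (choose t)
  feasible : ∀ t h s, ∀ᵐ a ∂(choose t (h, s)), a ∈ S.actions s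

/-- A `(z, Ω)`-only policy: a stationary randomized choice of `I(t)` given `(z(t), Ω(t))`. -/
structure StationaryPolicy (S : Network N Z W A M) where
  choose : Kernel (Z × (W × Bool)) A
  markov : IsMarkovKernel choose
  feasible : ∀ s, ∀ᵐ a ∂(choose s), a ∈ S.actions s

/-- A `(z, Ω)`-only policy is a policy. -/
def StationaryPolicy.toPolicy {S : Network N Z W A M} (p : S.StationaryPolicy) : S.Policy where
  choose _ := p.choose.comap Prod.snd measurable_snd
  markov _ := by
    have := p.markov
    infer_instance
  feasible _ h s := by
    rw [Kernel.comap_apply]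
    exact p.feasible s

/-- The law of `(z(0), Ω(0), I(0))`, with `z(0) = 0`. -/
def Policy.init {S : Network N Z W A M} (p : S.Policy) : Measure (Slot Z W A) :=
  ((Measure.dirac S.zero).prod S.outcomeLaw) ⊗ₘ
    ((p.choose 0).comap (fun s => (Fin.elim0, s)) (by fun_prop))

/-- The conditional law of `(z(t+1), Ω(t+1), I(t+1))` given the slots `0, …, t`: the state moves
by the transition kernel, `Ω(t+1)` is independent of it and of the past, and `I(t+1)` is chosen
by the policy. -/
def Policy.step {S : Network N Z W A M} (p : S.Policy) (t : ℕ) :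
    Kernel ((_i : Finset.Iic t) → Slot Z W A) (Slot Z W A) :=
  ((S.trans.comap (fun h => h ⟨t, Finset.mem_Iic.2 le_rfl⟩) (by fun_prop)) ×ₖ
      (Kernel.const _ S.outcomeLaw)) ⊗ₖ
    ((p.choose (t + 1)).comap
      (fun hs : ((_i : Finset.Iic t) → Slot Z W A) × (Z × (W × Bool)) =>
        ((fun i : Fin (t + 1) => hs.1 ⟨i, Finset.mem_Iic.2 (Nat.lt_succ_iff.1 i.2)⟩), hs.2))
      (by fun_prop))

instance (S : Network N Z W A M) : IsProbabilityMeasure S.law := S.law_prob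

instance (S : Network N Z W A M) : IsMarkovKernel S.trans := S.trans_markov

instance (S : Network N Z W A M) : IsProbabilityMeasure S.outcomeLaw := by
  unfold outcomeLaw
  infer_instance

instance {S : Network N Z W A M} (p : S.Policy) (t : ℕ) : IsMarkovKernel (p.choose t) :=
  p.markov t

instance {S : Network N Z W A M} (p : S.Policy) : IsProbabilityMeasure p.init := by
  unfold Policy.init
  infer_instance

instance {S : Network N Z W A M} (p : S.Policy) (t : ℕ) : IsMarkovKernel (p.step t) := by
  unfold Policy.step
  infer_instance

/-- The probability measure of the sample paths under a policy. -/
def Policy.prob {S : Network N Z W A M} (p : S.Policy) : Measure (SamplePath Z W A) :=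
  Kernel.trajMeasure (X := fun _ => Slot Z W A) p.init p.step

/-- `d̂_n = μ̂_n - R̂_n`. -/
def drain (S : Network N Z W A M) (n : N) (s : Slot Z W A) : ℝ := S.service n s - S.arrival n s

/-- The queue backlogs `Q_n(t)`. -/
def queue (S : Network N Z W A M) (n : N) : ℕ → SamplePath Z W A → ℝ
  | 0, _ => 0
  | t + 1, path =>
    max (S.queue n t path - S.service n (path t)) 0 + S.arrival n (path t)

/-- The virtual queues `Y_m(t)`. -/
def virtualQueue (S : Network N Z W A M) (m : Fin M) : ℕ → SamplePath Z W A → ℝ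
  | 0, _ => 0
  | t + 1, path =>
    max (S.virtualQueue m t path - S.target m + S.penalty m.succ (path t)) 0

/-- Slot `t` is a renewal. -/
def IsRenewal (S : Network N Z W A M) (r : RenewalRule Z W A) (path : SamplePath Z W A) (t : ℕ) :
    Prop :=
  t = 0 ∨ ((path t).1.1 = S.zero ∧ past t path ∈ r.criterion t)

/-- The slot `t_g` of the `g`-th renewal, with `t_0 = 0` (and the value `0` if there are at
most `g` renewals). -/
def renewalTime (S : Network N Z W A M) (r : RenewalRule Z W A) (g : ℕ) (path : SamplePath Z W A) : ℕ :=
  Nat.nth (S.IsRenewal r path) g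

/-- The length `T_g = t_{g+1} - t_g` of the `g`-th renewal interval. -/
def renewalLength (S : Network N Z W A M) (r : RenewalRule Z W A) (g : ℕ) (path : SamplePath Z W A) :
    ℕ :=
  S.renewalTime r (g + 1) path - S.renewalTime r g path

/-- The time from slot `t` to the next renewal, `∞` if there is none. -/
def timeToRenewal (S : Network N Z W A M) (r : RenewalRule Z W A) (t : ℕ) (path : SamplePath Z W A) :
    ℝ≥0∞ :=
  ⨅ k : {k : ℕ // 0 < k ∧ S.IsRenewal r path (t + k)}, ((k : ℕ) : ℝ≥0∞)

/-- The length of the `g`-th renewal interval, together with the decisions and penalties in it. -/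
def renewalBlock (S : Network N Z W A M) (r : RenewalRule Z W A) (g : ℕ) (path : SamplePath Z W A) :
    ℕ × (ℕ → (A × (Fin (M + 1) → ℝ)) ⊕ Unit) :=
  (S.renewalLength r g path, fun τ =>
    if τ < S.renewalLength r g path then
      Sum.inl ((path (S.renewalTime r g path + τ)).2,
        fun m => S.penalty m (path (S.renewalTime r g path + τ)))
    else Sum.inr ())

/-- The requirements on a definition of renewals: under all policies the first and second moments
of the inter-renewal times are bounded, whatever the history before the renewal; and under every
`(z, Ω)`-only policy the renewal intervals are independent and identically distributed. -/
structure RenewalRequirements (S : Network N Z W A M) (r : RenewalRule Z W A) : Prop where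
  moments : ∃ m₁ m₂ : ℝ≥0, ∀ (p : S.Policy) (t : ℕ) (H : Set (Fin t → Slot Z W A)),
    MeasurableSet H →
      ∫⁻ path in {path | S.IsRenewal r path t ∧ past t path ∈ H},
          S.timeToRenewal r t path ∂p.prob
        ≤ m₁ * p.prob {path | S.IsRenewal r path t ∧ past t path ∈ H} ∧
      ∫⁻ path in {path | S.IsRenewal r path t ∧ past t path ∈ H},
          S.timeToRenewal r t path ^ 2 ∂p.prob
        ≤ m₂ * p.prob {path | S.IsRenewal r path t ∧ past t path ∈ H}
  iid : ∀ p : S.StationaryPolicy,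
    iIndepFun (fun g => S.renewalBlock r g) p.toPolicy.prob ∧
    ∀ g, IdentDistrib (S.renewalBlock r g) (S.renewalBlock r 0) p.toPolicy.prob p.toPolicy.prob

/-- The sum of a slot quantity `f` over the `g`-th renewal interval. -/
def renewalSum (S : Network N Z W A M) (r : RenewalRule Z W A) (f : Slot Z W A → ℝ) (g : ℕ)
    (path : SamplePath Z W A) : ℝ :=
  ∑ τ ∈ Finset.range (S.renewalLength r g path), f (path (S.renewalTime r g path + τ))

/-- The mean length `E[T]` of the first renewal interval under a policy. -/
def meanLength (S : Network N Z W A M) (r : RenewalRule Z W A) (p : S.Policy) : ℝ :=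
  ∫ path, (S.renewalLength r 0 path : ℝ) ∂p.prob

/-- The `(z, Ω)`-only policy `p` meets the constraints with slackness `ε`. -/
def HasSlack (S : Network N Z W A M) (r : RenewalRule Z W A) (p : S.StationaryPolicy) (ε : ℝ) :
    Prop :=
  (∀ m : Fin M,
    (∫ path, S.renewalSum r (S.penalty m.succ) 0 path ∂p.toPolicy.prob) /
      S.meanLength r p.toPolicy ≤ S.target m - ε) ∧
  ∀ n : N,
    ε ≤ (∫ path, S.renewalSum r (S.drain n) 0 path ∂p.toPolicy.prob) /
      S.meanLength r p.toPolicy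

/-- The slack `T x_m^av - ∑ x_m` of the penalty `m` over the `g`-th renewal interval. -/
def penaltySlack (S : Network N Z W A M) (r : RenewalRule Z W A) (m : Fin M) (g : ℕ)
    (path : SamplePath Z W A) : ℝ :=
  S.renewalLength r g path * S.target m - S.renewalSum r (S.penalty m.succ) g path

/-- The optimal value of the weighted stochastic shortest path problem over one renewal interval
that starts in state `0`, with the backlogs `q` and `y` as weights. -/
def shortestPathValue [Fintype N] (S : Network N Z W A M) (r : RenewalRule Z W A)
    (q : N → ℝ) (y : Fin M → ℝ) : ℝ :=
  ⨅ p : S.Policy,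
    (-∑ n, q n * ∫ path, S.renewalSum r (S.drain n) 0 path ∂p.prob)
      - ∑ m, y m * ∫ path, S.penaltySlack r m 0 path ∂p.prob

/-- The queue vector `Θ(t_g)` at the `g`-th renewal. -/
def backlog (S : Network N Z W A M) (r : RenewalRule Z W A) (g : ℕ) (path : SamplePath Z W A) :
    (N → ℝ) × (Fin M → ℝ) :=
  (fun n => S.queue n (S.renewalTime r g path) path,
    fun m => S.virtualQueue m (S.renewalTime r g path) path)

/-- The σ-algebra generated by `Θ(t_g)`. -/
@[reducible] def backlogSigma (S : Network N Z W A M) (r : RenewalRule Z W A) (g : ℕ) :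
    MeasurableSpace (SamplePath Z W A) :=
  MeasurableSpace.comap (S.backlog r g) inferInstance

/-- The quantity `D(Θ(t_g))` under the policy `p`. -/
def driftBound [Fintype N] (S : Network N Z W A M) (r : RenewalRule Z W A) (p : S.Policy) (g : ℕ)
    (path : SamplePath Z W A) : ℝ :=
  (-∑ n, (S.backlog r g path).1 n *
      (p.prob[S.renewalSum r (S.drain n) g | S.backlogSigma r g]) path)
    - ∑ m, (S.backlog r g path).2 m *
      (p.prob[S.penaltySlack r m g | S.backlogSigma r g]) path

/-- At every renewal, the policy `p` solves the weighted stochastic shortest path problem up to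
the error `C + δ ∑ Q_n(t_g) + δ ∑ Y_m(t_g)`. -/
def ApproxShortestPath [Fintype N] (S : Network N Z W A M) (r : RenewalRule Z W A) (p : S.Policy)
    (C δ : ℝ) : Prop :=
  ∀ g, ∀ᵐ path ∂p.prob,
    S.driftBound r p g path ≤
      S.shortestPathValue r (S.backlog r g path).1 (S.backlog r g path).2
        + C + δ * ∑ n, (S.backlog r g path).1 n + δ * ∑ m, (S.backlog r g path).2 m

/-- `sigmaSq` bounds `∑ [μ_n(t)² + R_n(t)²] + ∑ (x_m(t) - x_m^av)²` in all slots. -/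
def IsSlotBound [Fintype N] (S : Network N Z W A M) (p : S.Policy) (sigmaSq : ℝ) : Prop :=
  ∀ᵐ path ∂p.prob, ∀ t,
    ∑ n, (S.service n (path t) ^ 2 + S.arrival n (path t) ^ 2)
      + ∑ m : Fin M, (S.penalty m.succ (path t) - S.target m) ^ 2 ≤ sigmaSq

/-- The constant `B = (σ² / 2) sup E[T² | Θ(t_g)]`, the supremum being taken over all the renewals
and over (almost) all the values of `Θ(t_g)`. -/
def driftConst (S : Network N Z W A M) (r : RenewalRule Z W A) (p : S.Policy) (sigmaSq : ℝ) : ℝ :=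
  sigmaSq / 2 * ⨆ g : ℕ,
    essSup (p.prob[fun path => (S.renewalLength r g path : ℝ) ^ 2 | S.backlogSigma r g]) p.prob

/-- Strong stability of a nonnegative process `f`:
`limsup (1/t) ∑_{τ < t} E[f(τ)] < ∞`. -/
def Policy.StronglyStable {S : Network N Z W A M} (p : S.Policy) (f : ℕ → SamplePath Z W A → ℝ) : Prop :=
  limsup (fun t : ℕ =>
    (∑ τ ∈ Finset.range t, ∫⁻ path, ENNReal.ofReal (f τ path) ∂p.prob) / (t : ℝ≥0∞)) atTop < ⊤

/-- The time average `limsup (1/t) ∑_{τ < t} E[x_m(τ)]` of a penalty, as an extended real. -/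
def Policy.timeAverage {S : Network N Z W A M} (p : S.Policy) (m : Fin (M + 1)) : EReal :=
  limsup (fun t : ℕ =>
    (((∑ τ ∈ Finset.range t, ∫ path, S.penalty m (path τ) ∂p.prob) / (t : ℝ) : ℝ) : EReal)) atTop

end Network

end

/-! The proof is a Lyapunov argument with the sum of the squared backlogs, sampled at the renewals
instead of at every slot. Over an interval of length T, the square of a backlog grows by at most
twice its starting value times the net input of the interval, plus T times the sum of the second
order terms (`level_add_sq_le`). Summed over the queues, the last term is at most σ²T². In
expectation the cross term becomes the mean of `driftBound`, by pulling the backlog out of the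
conditional expectation, and the last term is at most 2B (`integral_sq_succ_le`).

The policy I* competes in the shortest path problem, and its slack gives D^ssp(Θ) ≤ -ε E[T*] (∑ Q +
∑ Y). Hence E[D(Θ(t_g))] ≤ C - κ E[∑ Q + ∑ Y] with κ = ε E[T*] - δ > 0. Telescoping from empty
queues and dropping the final squares gives the bound (B + C)/κ.

To pass to slots, the first t renewal intervals cover the first t slots, and inside an interval a
backlog exceeds its starting value by at most a constant times the length. The moments of T_g given
Θ(t_g) are bounded, so the averages over slots are bounded as well, which is strong stability. A
mean backlog with bounded averages and bounded decrease per slot is O(√t); since Y_m(t) dominates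
the sum of x_m - x_m^av, the time average constraints follow.

For the mean length, E[T] is the sum of the probabilities of T > k. This event excludes forced
renewals in the first k slots, which has probability (1 - φ)^k; for type 2 the two events agree
almost surely. -/

/-! ### A quadratic inequality for sequences with controlled increments. -/

theorem sq_le_of_increments {u c b v : ℕ → ℝ} (hub : ∀ k, |u (k + 1) - u k| ≤ b k)
    (hcb : ∀ k, |c k| ≤ b k) (hbv : ∀ k, b k ^ 2 ≤ v k)
    (hu : ∀ k, u (k + 1) ^ 2 ≤ u k ^ 2 + 2 * u k * c k + v k) (T : ℕ) :
    u T ^ 2 ≤ u 0 ^ 2 + 2 * u 0 * ∑ k ∈ Finset.range T, c k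
      + T * ∑ k ∈ Finset.range T, v k := by
  have hb : ∀ k, 0 ≤ b k := fun k => (abs_nonneg _).trans (hcb k)
  have h1 : ∀ k, |u k - u 0| ≤ ∑ j ∈ Finset.range k, b j := by
    intro k
    induction k with
    | zero => simp
    | succ k ih =>
      rw [Finset.sum_range_succ]
      calc |u (k + 1) - u 0| = |(u k - u 0) + (u (k + 1) - u k)| := by ring_nf
        _ ≤ _ := (abs_add_le _ _).trans (add_le_add ih (hub k))
  -- Replacing `u k` by `u 0` in the cross term costs at most the products `b j * b k` with `j < k`.
  -- These are the off-diagonal terms of the square of `∑ b`, so only the excess `v k - b k ^ 2`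
  -- remains outside.
  have h2 : ∀ T, u T ^ 2 ≤ u 0 ^ 2 + 2 * u 0 * ∑ k ∈ Finset.range T, c k
      + (∑ k ∈ Finset.range T, b k) ^ 2 + ∑ k ∈ Finset.range T, (v k - b k ^ 2) := by
    intro T
    induction T with
    | zero => simp
    | succ T ih =>
      simp only [Finset.sum_range_succ]
      have h3 : (u T - u 0) * c T ≤ (∑ k ∈ Finset.range T, b k) * b T :=
        (le_abs_self _).trans (by
          rw [abs_mul]
          exact mul_le_mul (h1 T) (hcb T) (abs_nonneg _) (Finset.sum_nonneg fun i _ => hb i))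
      nlinarith [hu T]
  have h4 : (∑ k ∈ Finset.range T, b k) ^ 2 ≤ T * ∑ k ∈ Finset.range T, b k ^ 2 := by
    simpa using sq_sum_le_card_mul_sum_sq (s := Finset.range T) (f := b)
  -- The excess is nonnegative and may carry the factor `T` too; it then recombines with
  -- Cauchy–Schwarz for `∑ b` to `T * ∑ v`.
  have h5 : ∑ k ∈ Finset.range T, (v k - b k ^ 2) ≤ T * ∑ k ∈ Finset.range T, (v k - b k ^ 2) := by
    rcases Nat.eq_zero_or_pos T with rfl | hT
    · simp
    · refine le_mul_of_one_le_left (Finset.sum_nonneg fun i _ => sub_nonneg.2 (hbv i)) ?_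
      exact_mod_cast hT
  have h6 := h2 T
  rw [Finset.sum_sub_distrib] at h5 h6
  nlinarith

/-! ### Pathwise bounds of the backlogs. -/

namespace Network

section Deterministic

variable {N Z W A : Type*} {M : ℕ}
  [MeasurableSpace Z] [MeasurableSpace W] [MeasurableSpace A]

/-- The backlogs of the actual and of the virtual queues. -/
def level (S : Network N Z W A M) : N ⊕ Fin M → ℕ → SamplePath Z W A → ℝ
  | .inl n => S.queue n
  | .inr m => S.virtualQueue m

/-- The increments of the queues before truncation. -/
def increment (S : Network N Z W A M) : N ⊕ Fin M → Slot Z W A → ℝ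
  | .inl n => fun s => -S.drain n s
  | .inr m => fun s => S.penalty m.succ s - S.target m

/-- The second order terms of the squared increments. -/
def squareTerm (S : Network N Z W A M) : N ⊕ Fin M → Slot Z W A → ℝ
  | .inl n => fun s => S.service n s ^ 2 + S.arrival n s ^ 2
  | .inr m => fun s => (S.penalty m.succ s - S.target m) ^ 2

/-- The absolute change of a backlog in a slot is at most `stepSize`. -/
def stepSize (S : Network N Z W A M) : N ⊕ Fin M → Slot Z W A → ℝ
  | .inl n => fun s => max (S.service n s) (S.arrival n s)
  | .inr m => fun s => |S.penalty m.succ s - S.target m|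

/-- A uniform bound of `stepSize`. -/
def stepMax (S : Network N Z W A M) : N ⊕ Fin M → ℝ
  | .inl n => |S.serviceMax n| + |S.arrivalMax n|
  | .inr m => |S.penaltyMin m.succ| + |S.penaltyMax m.succ| + |S.target m|

/-- All the actions of a sample path are available ones. -/
def Feasible (S : Network N Z W A M) (path : SamplePath Z W A) : Prop :=
  ∀ t, (path t).2 ∈ S.actions (path t).1

variable {S : Network N Z W A M} {path : SamplePath Z W A}

theorem stepMax_nonneg (S : Network N Z W A M) (i : N ⊕ Fin M) : 0 ≤ S.stepMax i := by
  cases i <;> simp only [stepMax] <;> positivity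

@[simp]
theorem level_zero (i : N ⊕ Fin M) : S.level i 0 path = 0 := by
  cases i <;> rfl

theorem level_nonneg (h : S.Feasible path) (i : N ⊕ Fin M) (t : ℕ) : 0 ≤ S.level i t path := by
  cases t with
  | zero => simp
  | succ t =>
    rcases i with n | m
    · have := (S.arrival_bound n _ (h t)).1
      simp only [level, queue]
      positivity
    · exact le_max_right _ _

theorem abs_increment_le_stepSize {s : Slot Z W A} (h : s.2 ∈ S.actions s.1) (i : N ⊕ Fin M) :
    |S.increment i s| ≤ S.stepSize i s := by
  rcases i with n | m
  · have h1 := (S.service_bound n _ h).1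
    have h2 := (S.arrival_bound n _ h).1
    simp only [increment, stepSize, drain, abs_neg]
    rw [abs_le]
    constructor
    · linarith [le_max_right (S.service n s) (S.arrival n s)]
    · linarith [le_max_left (S.service n s) (S.arrival n s)]
  · exact le_rfl

theorem stepSize_le_stepMax {s : Slot Z W A} (h : s.2 ∈ S.actions s.1) (i : N ⊕ Fin M) :
    S.stepSize i s ≤ S.stepMax i := by
  rcases i with n | m
  · have h1 := (S.service_bound n _ h).2
    have h2 := (S.arrival_bound n _ h).2
    simp only [stepSize, stepMax]
    refine max_le ?_ ?_
    · linarith [le_abs_self (S.serviceMax n), abs_nonneg (S.arrivalMax n)]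
    · linarith [le_abs_self (S.arrivalMax n), abs_nonneg (S.serviceMax n)]
  · obtain ⟨h1, h2⟩ := S.penalty_bound m.succ _ h
    simp only [stepSize, stepMax]
    rw [abs_le]
    constructor
    · linarith [neg_abs_le (S.penaltyMin m.succ), abs_nonneg (S.penaltyMax m.succ),
        le_abs_self (S.target m)]
    · linarith [le_abs_self (S.penaltyMax m.succ), abs_nonneg (S.penaltyMin m.succ),
        neg_abs_le (S.target m)]

theorem abs_increment_le {s : Slot Z W A} (h : s.2 ∈ S.actions s.1) (i : N ⊕ Fin M) :
    |S.increment i s| ≤ S.stepMax i :=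
  (abs_increment_le_stepSize h i).trans (stepSize_le_stepMax h i)

/-- This is why `stepSize` is a maximum: the cruder step μ + R has a square that may exceed μ² + R².
-/
theorem stepSize_sq_le_squareTerm (s : Slot Z W A) (i : N ⊕ Fin M) :
    S.stepSize i s ^ 2 ≤ S.squareTerm i s := by
  rcases i with n | m
  · simp only [stepSize, squareTerm]
    rcases max_choice (S.service n s) (S.arrival n s) with h | h <;> rw [h] <;>
      nlinarith [sq_nonneg (S.service n s), sq_nonneg (S.arrival n s)]
  · simp [stepSize, squareTerm]

theorem abs_level_succ_sub_le (h : S.Feasible path) (i : N ⊕ Fin M) (t : ℕ) :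
    |S.level i (t + 1) path - S.level i t path| ≤ S.stepSize i (path t) := by
  have h0 := level_nonneg h i t
  rcases i with n | m
  · have h1 := (S.service_bound n _ (h t)).1
    have h2 := (S.arrival_bound n _ (h t)).1
    simp only [level, queue, stepSize] at h0 ⊢
    have h3 := le_max_left (S.service n (path t)) (S.arrival n (path t))
    have h4 := le_max_right (S.service n (path t)) (S.arrival n (path t))
    rcases max_cases (S.queue n t path - S.service n (path t)) 0 with ⟨h, h'⟩ | ⟨h, h'⟩ <;>
      rw [h, abs_le] <;> constructor <;> linarith
  · simp only [level, virtualQueue, stepSize] at h0 ⊢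
    have h3 := le_abs_self (S.penalty m.succ (path t) - S.target m)
    have h4 := neg_abs_le (S.penalty m.succ (path t) - S.target m)
    rcases max_cases (S.virtualQueue m t path - S.target m + S.penalty m.succ (path t)) 0
      with ⟨h, h'⟩ | ⟨h, h'⟩ <;> rw [h, abs_le] <;> constructor <;> linarith

theorem level_succ_sq_le (h : S.Feasible path) (i : N ⊕ Fin M) (t : ℕ) :
    S.level i (t + 1) path ^ 2 ≤ S.level i t path ^ 2
      + 2 * S.level i t path * S.increment i (path t) + S.squareTerm i (path t) := by
  have h0 := level_nonneg h i t
  rcases i with n | m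
  · have h1 := (S.service_bound n _ (h t)).1
    have h2 := (S.arrival_bound n _ (h t)).1
    simp only [level, queue, increment, drain, squareTerm] at h0 ⊢
    rcases max_cases (S.queue n t path - S.service n (path t)) 0 with ⟨h, h'⟩ | ⟨h, h'⟩ <;>
      rw [h] <;> nlinarith [mul_nonneg h1 h2, mul_nonneg h0 h2,
        sq_nonneg (S.queue n t path - S.service n (path t))]
  · simp only [level, virtualQueue, increment, squareTerm] at h0 ⊢
    rcases max_cases (S.virtualQueue m t path - S.target m + S.penalty m.succ (path t)) 0
      with ⟨h, h'⟩ | ⟨h, h'⟩ <;> rw [h] <;>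
      nlinarith [sq_nonneg (S.virtualQueue m t path - S.target m + S.penalty m.succ (path t))]

/-- The cross term carries the backlog at the start of the interval, not the current one; this lets
it be pulled out of a conditional expectation given Θ(t_g). -/
theorem level_add_sq_le (h : S.Feasible path) (i : N ⊕ Fin M) (t T : ℕ) :
    S.level i (t + T) path ^ 2 ≤ S.level i t path ^ 2
      + 2 * S.level i t path * ∑ k ∈ Finset.range T, S.increment i (path (t + k))
      + T * ∑ k ∈ Finset.range T, S.squareTerm i (path (t + k)) :=
  sq_le_of_increments (u := fun k => S.level i (t + k) path)
    (b := fun k => S.stepSize i (path (t + k)))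
    (fun k => abs_level_succ_sub_le h i (t + k))
    (fun k => abs_increment_le_stepSize (h (t + k)) i)
    (fun _ => stepSize_sq_le_squareTerm _ i)
    (fun k => level_succ_sq_le h i (t + k)) T

theorem abs_level_add_sub_le (h : S.Feasible path) (i : N ⊕ Fin M) (t k : ℕ) :
    |S.level i (t + k) path - S.level i t path| ≤ k * S.stepMax i := by
  induction k with
  | zero => simp
  | succ k ih =>
    have h1 := (abs_level_succ_sub_le h i (t + k)).trans (stepSize_le_stepMax (h (t + k)) i)
    calc |S.level i (t + (k + 1)) path - S.level i t path|
        = |(S.level i (t + k) path - S.level i t path)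
          + (S.level i (t + k + 1) path - S.level i (t + k) path)| := by ring_nf
      _ ≤ _ := (abs_add_le _ _).trans (add_le_add ih h1)
      _ = _ := by push_cast; ring

theorem level_le (h : S.Feasible path) (i : N ⊕ Fin M) (t : ℕ) :
    S.level i t path ≤ t * S.stepMax i := by
  have := (le_abs_self _).trans (abs_level_add_sub_le h i 0 t)
  simpa using this

/-- Truncation at 0 can only raise the virtual queue. -/
theorem sum_increment_le_level (path : SamplePath Z W A) (m : Fin M) (t : ℕ) :
    ∑ τ ∈ Finset.range t, (S.penalty m.succ (path τ) - S.target m)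
      ≤ S.level (.inr m) t path := by
  induction t with
  | zero => simp
  | succ t ih =>
    rw [Finset.sum_range_succ]
    refine le_trans ?_ (le_max_left _ _)
    simp only [level] at ih
    linarith

/-! ### Renewal intervals along a sample path. -/

variable {r : RenewalRule Z W A}

theorem isRenewal_zero (path : SamplePath Z W A) : S.IsRenewal r path 0 := Or.inl rfl

@[simp]
theorem renewalTime_zero (path : SamplePath Z W A) : S.renewalTime r 0 path = 0 :=
  Nat.nth_zero_of_zero (isRenewal_zero path)

theorem backlog_fst (g : ℕ) (n : N) :
    (S.backlog r g path).1 n = S.level (.inl n) (S.renewalTime r g path) path := rfl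

theorem backlog_snd (g : ℕ) (m : Fin M) :
    (S.backlog r g path).2 m = S.level (.inr m) (S.renewalTime r g path) path := rfl

theorem abs_renewalSum_le (h : S.Feasible path) {f : Slot Z W A → ℝ} {K : ℝ}
    (hf : ∀ s : Slot Z W A, s.2 ∈ S.actions s.1 → |f s| ≤ K) (g : ℕ) :
    |S.renewalSum r f g path| ≤ K * S.renewalLength r g path := by
  refine (Finset.abs_sum_le_sum_abs _ _).trans ?_
  refine (Finset.sum_le_sum fun i _ => hf _ (h _)).trans_eq ?_
  simp [mul_comm]

theorem renewalSum_increment_inl (n : N) (g : ℕ) (path : SamplePath Z W A) :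
    S.renewalSum r (S.increment (.inl n)) g path = -S.renewalSum r (S.drain n) g path := by
  simp [renewalSum, increment]

theorem renewalSum_increment_inr (m : Fin M) (g : ℕ) (path : SamplePath Z W A) :
    S.renewalSum r (S.increment (.inr m)) g path = -S.penaltySlack r m g path := by
  simp [renewalSum, increment, penaltySlack, Finset.sum_sub_distrib]

theorem renewalTime_succ_le {g t : ℕ} (ht : S.IsRenewal r path t)
    (hg : S.renewalTime r g path < t) : S.renewalTime r (g + 1) path ≤ t := by
  by_contra hlt
  exact absurd (Nat.le_nth_of_lt_nth_succ (not_le.1 hlt) ht) (not_le.2 hg)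

/-- A feasible sample path with infinitely many renewals. -/
structure Regular (S : Network N Z W A M) (r : RenewalRule Z W A) (path : SamplePath Z W A) :
    Prop where
  feasible : S.Feasible path
  infinite : (Set.ofPred (S.IsRenewal r path)).Infinite

namespace Regular

variable (h : S.Regular r path)
include h

theorem isRenewal_renewalTime (g : ℕ) : S.IsRenewal r path (S.renewalTime r g path) :=
  Nat.nth_mem_of_infinite h.infinite g

theorem renewalTime_lt (g : ℕ) : S.renewalTime r g path < S.renewalTime r (g + 1) path :=
  Nat.nth_strictMono h.infinite g.lt_succ_self

theorem renewalTime_succ (g : ℕ) :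
    S.renewalTime r (g + 1) path = S.renewalTime r g path + S.renewalLength r g path := by
  have := h.renewalTime_lt g
  unfold renewalLength
  omega

theorem one_le_renewalLength (g : ℕ) : 1 ≤ S.renewalLength r g path := by
  have := h.renewalTime_lt g
  unfold renewalLength
  omega

theorem le_renewalTime (g : ℕ) : g ≤ S.renewalTime r g path :=
  (Nat.nth_strictMono h.infinite).le_apply

theorem renewalTime_eq_sum (g : ℕ) :
    S.renewalTime r g path = ∑ k ∈ Finset.range g, S.renewalLength r k path := by
  induction g with
  | zero => simp
  | succ g ih => rw [h.renewalTime_succ, Finset.sum_range_succ, ih]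

theorem timeToRenewal_renewalTime (g : ℕ) :
    S.timeToRenewal r (S.renewalTime r g path) path = S.renewalLength r g path := by
  refine le_antisymm ?_ ?_
  · refine iInf_le_of_le ⟨S.renewalLength r g path, h.one_le_renewalLength g, ?_⟩ le_rfl
    rw [← h.renewalTime_succ]
    exact h.isRenewal_renewalTime _
  · refine le_iInf fun k => ?_
    have := renewalTime_succ_le (g := g) k.2.2 (by have := k.2.1; omega)
    rw [h.renewalTime_succ] at this
    exact_mod_cast (by omega : S.renewalLength r g path ≤ k)

theorem sum_range_renewalTime (f : ℕ → ℝ) (g : ℕ) :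
    ∑ τ ∈ Finset.range (S.renewalTime r g path), f τ
      = ∑ j ∈ Finset.range g, ∑ k ∈ Finset.range (S.renewalLength r j path),
          f (S.renewalTime r j path + k) := by
  induction g with
  | zero => simp
  | succ g ih => rw [h.renewalTime_succ, Finset.sum_range_add, Finset.sum_range_succ, ih]

/-- Each interval has at least one slot, so the first `t` of them cover all slots below `t`; the
additional slots only add nonnegative terms. -/
theorem sum_level_le (i : N ⊕ Fin M) (t : ℕ) :
    ∑ τ ∈ Finset.range t, S.level i τ path
      ≤ ∑ g ∈ Finset.range t, (S.level i (S.renewalTime r g path) path * S.renewalLength r g path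
          + S.stepMax i * (S.renewalLength r g path : ℝ) ^ 2) := by
  calc ∑ τ ∈ Finset.range t, S.level i τ path
      ≤ ∑ τ ∈ Finset.range (S.renewalTime r t path), S.level i τ path :=
        Finset.sum_le_sum_of_subset_of_nonneg
          (Finset.range_subset_range.2 (h.le_renewalTime t))
          fun τ _ _ => level_nonneg h.feasible i τ
    _ = _ := h.sum_range_renewalTime _ t
    _ ≤ _ := by
      refine Finset.sum_le_sum fun g _ => ?_
      have : ∀ k ∈ Finset.range (S.renewalLength r g path),
          S.level i (S.renewalTime r g path + k) path
            ≤ S.level i (S.renewalTime r g path) path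
              + S.stepMax i * S.renewalLength r g path := by
        intro k hk
        have h1 := (le_abs_self _).trans
          (abs_level_add_sub_le h.feasible i (S.renewalTime r g path) k)
        have h2 : (k : ℝ) ≤ S.renewalLength r g path := by
          exact_mod_cast (Finset.mem_range.1 hk).le
        have h3 := mul_le_mul_of_nonneg_right h2 (S.stepMax_nonneg i)
        linarith
      refine (Finset.sum_le_sum this).trans_eq ?_
      simp only [Finset.sum_const, Finset.card_range, nsmul_eq_mul]
      ring

theorem level_renewalTime_succ_sq_le (i : N ⊕ Fin M) (g : ℕ) :
    S.level i (S.renewalTime r (g + 1) path) path ^ 2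
      ≤ S.level i (S.renewalTime r g path) path ^ 2
        + 2 * S.level i (S.renewalTime r g path) path * S.renewalSum r (S.increment i) g path
        + S.renewalLength r g path * S.renewalSum r (S.squareTerm i) g path := by
  rw [h.renewalTime_succ]
  exact level_add_sq_le h.feasible i _ _

end Regular

/-- An infimum over the empty set is `∞`, so a finite `timeToRenewal` produces a later renewal. -/
theorem infinite_renewals
    (h : ∀ t, S.IsRenewal r path t → S.timeToRenewal r t path < ∞) :
    (Set.ofPred (S.IsRenewal r path)).Infinite := by
  have key : ∀ t, S.IsRenewal r path t → ∃ k, 0 < k ∧ S.IsRenewal r path (t + k) := by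
    intro t ht
    by_contra hcon
    push Not at hcon
    have : IsEmpty {k : ℕ // 0 < k ∧ S.IsRenewal r path (t + k)} :=
      ⟨fun k => hcon k k.2.1 k.2.2⟩
    have h1 := h t ht
    simp [timeToRenewal, iInf_of_isEmpty] at h1
  refine Set.infinite_of_forall_exists_gt fun a => ?_
  induction a with
  | zero =>
    obtain ⟨k, hk, hk'⟩ := key 0 (isRenewal_zero path)
    exact ⟨0 + k, hk', by omega⟩
  | succ a ih =>
    obtain ⟨b, hb, hab⟩ := ih
    obtain ⟨k, hk, hk'⟩ := key b hb
    exact ⟨b + k, hk', by omega⟩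

end Deterministic

end Network

/-! ### Measurability of renewal times, backlogs and interval sums. -/

namespace Network

section Measurability

variable {N Z W A : Type*} {M : ℕ}
  [MeasurableSpace Z] [MeasurableSpace W] [MeasurableSpace A]
  {S : Network N Z W A M} {r : RenewalRule Z W A}
  {Ω : Type*} [MeasurableSpace Ω] {X : Ω → SamplePath Z W A} {t : ℕ}

theorem measurable_level (i : N ⊕ Fin M) (hX : ∀ s < t, Measurable fun ω => X ω s) :
    Measurable fun ω => S.level i t (X ω) := by
  induction t with
  | zero => simp
  | succ t ih =>
    have h1 := ih fun s hs => hX s (hs.trans t.lt_succ_self)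
    have h2 := hX t t.lt_succ_self
    rcases i with n | m
    · exact ((h1.sub ((S.measurable_service n).comp h2)).max measurable_const).add
        ((S.measurable_arrival n).comp h2)
    · exact ((h1.sub measurable_const).add ((S.measurable_penalty m.succ).comp h2)).max
        measurable_const

theorem measurable_increment (S : Network N Z W A M) (i : N ⊕ Fin M) :
    Measurable (S.increment i) := by
  rcases i with n | m
  · exact ((S.measurable_service n).sub (S.measurable_arrival n)).neg
  · exact (S.measurable_penalty m.succ).sub measurable_const

variable [MeasurableSingletonClass Z]

theorem measurableSet_isRenewal (hX : ∀ s ≤ t, Measurable fun ω => X ω s) :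
    MeasurableSet {ω | S.IsRenewal r (X ω) t} := by
  have h1 : MeasurableSet {ω | (X ω t).1.1 = S.zero} :=
    (measurable_fst.comp (measurable_fst.comp (hX t le_rfl))) (measurableSet_singleton S.zero)
  have h2 : Measurable fun ω => past t (X ω) :=
    measurable_pi_lambda _ fun i => hX i i.2.le
  exact (MeasurableSet.const (t = 0)).union (h1.inter (h2 (r.measurableSet_criterion t)))

open Classical in
theorem measurable_count_isRenewal (hX : ∀ s < t, Measurable fun ω => X ω s) :
    Measurable fun ω => Nat.count (S.IsRenewal r (X ω)) t := by
  induction t with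
  | zero => simp
  | succ t ih =>
    simp only [Nat.count_succ]
    exact (ih fun s hs => hX s (hs.trans t.lt_succ_self)).add
      (Measurable.ite (measurableSet_isRenewal fun s hs => hX s (Nat.lt_succ_of_le hs))
        measurable_const measurable_const)

theorem measurableSet_isRenewal' (t : ℕ) :
    MeasurableSet {path : SamplePath Z W A | S.IsRenewal r path t} :=
  measurableSet_isRenewal fun s _ => measurable_pi_apply s

open Classical in
-- `Nat.nth` has the default value 0 when there are too few elements; `t ≠ 0` rules this case out.
theorem nth_eq_iff_of_ne_zero {q : ℕ → Prop} {g t : ℕ} (ht : t ≠ 0) :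
    Nat.nth q g = t ↔ q t ∧ Nat.count q t = g := by
  constructor
  · rintro rfl
    exact ⟨Nat.nth_mem_of_ne_zero ht, Nat.count_nth (Nat.lt_card_toFinset_of_nth_ne_zero ht)⟩
  · rintro ⟨h, rfl⟩
    exact Nat.nth_count h

theorem measurable_renewalTime (S : Network N Z W A M) (r : RenewalRule Z W A) (g : ℕ) :
    Measurable (S.renewalTime r g) := by
  classical
  have h : ∀ t, t ≠ 0 → MeasurableSet (S.renewalTime r g ⁻¹' {t}) := by
    intro t ht
    have : S.renewalTime r g ⁻¹' {t} = {path | S.IsRenewal r path t} ∩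
        (fun path => Nat.count (S.IsRenewal r path) t) ⁻¹' {g} := by
      ext path
      exact nth_eq_iff_of_ne_zero ht
    rw [this]
    exact (measurableSet_isRenewal' t).inter
      (measurable_count_isRenewal (fun s _ => measurable_pi_apply s) (measurableSet_singleton g))
  refine measurable_to_countable' fun t => ?_
  by_cases ht : t = 0
  -- The value 0 also absorbs the paths with too few renewals, so this event is obtained as a
  -- complement.
  · have : S.renewalTime r g ⁻¹' {t} = (⋃ s : {s : ℕ // s ≠ 0}, S.renewalTime r g ⁻¹' {s.1})ᶜ := by
      ext path
      simp only [ht, Set.mem_preimage, Set.mem_singleton_iff, Set.mem_compl_iff, Set.mem_iUnion]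
      exact ⟨fun h0 ⟨s, hs⟩ => s.2 (hs.symm.trans h0), fun h0 => by_contra fun h1 => h0 ⟨⟨_, h1⟩, rfl⟩⟩
    rw [this]
    exact (MeasurableSet.iUnion fun s : {s : ℕ // s ≠ 0} => h s.1 s.2).compl
  · exact h t ht

theorem measurable_renewalLength (S : Network N Z W A M) (r : RenewalRule Z W A) (g : ℕ) :
    Measurable (S.renewalLength r g) :=
  (measurable_renewalTime S r (g + 1)).sub (measurable_renewalTime S r g)

theorem measurable_renewalSum {f : Slot Z W A → ℝ} (hf : Measurable f) (g : ℕ) :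
    Measurable (S.renewalSum r f g) := by
  have h : Measurable fun q : (ℕ × ℕ) × SamplePath Z W A =>
      ∑ τ ∈ Finset.range q.1.1, f (q.2 (q.1.2 + τ)) :=
    measurable_from_prod_countable_right fun x =>
      Finset.measurable_fun_sum (Finset.range x.1) fun τ _ =>
        hf.comp (measurable_pi_apply (X := fun _ => Slot Z W A) (x.2 + τ))
  exact h.comp (((measurable_renewalLength S r g).prodMk (measurable_renewalTime S r g)).prodMk
    measurable_id)

theorem measurable_level_renewalTime (i : N ⊕ Fin M) (g : ℕ) :
    Measurable fun path => S.level i (S.renewalTime r g path) path := by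
  have h : Measurable fun q : ℕ × SamplePath Z W A => S.level i q.1 q.2 :=
    measurable_from_prod_countable_right fun t =>
      measurable_level (X := id) i fun s _ => measurable_pi_apply s
  exact h.comp ((measurable_renewalTime S r g).prodMk measurable_id)

theorem measurable_backlog (S : Network N Z W A M) (r : RenewalRule Z W A) (g : ℕ) :
    Measurable (S.backlog r g) :=
  (measurable_pi_lambda _ fun n => measurable_level_renewalTime (.inl n) g).prodMk
    (measurable_pi_lambda _ fun m => measurable_level_renewalTime (.inr m) g)

theorem backlogSigma_le (S : Network N Z W A M) (r : RenewalRule Z W A) (g : ℕ) :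
    S.backlogSigma r g ≤ (inferInstance : MeasurableSpace (SamplePath Z W A)) :=
  (measurable_backlog S r g).comap_le

omit [MeasurableSingletonClass Z] in
theorem measurable_backlogSigma_level (i : N ⊕ Fin M) (g : ℕ) :
    Measurable[S.backlogSigma r g] fun path => S.level i (S.renewalTime r g path) path := by
  have h : Measurable[S.backlogSigma r g] (S.backlog r g) := comap_measurable _
  rcases i with n | m
  · exact (measurable_pi_apply n).comp (measurable_fst.comp h)
  · exact (measurable_pi_apply m).comp (measurable_snd.comp h)

theorem measurable_timeToRenewal (S : Network N Z W A M) (r : RenewalRule Z W A) (t : ℕ) :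
    Measurable (S.timeToRenewal r t) := by
  classical
  have h : S.timeToRenewal r t = fun path => ⨅ k : ℕ,
      if 0 < k ∧ S.IsRenewal r path (t + k) then (k : ℝ≥0∞) else ∞ := by
    ext path
    simp only [timeToRenewal, iInf_subtype, iInf_eq_if]
  rw [h]
  exact Measurable.iInf fun k => Measurable.ite
    ((MeasurableSet.const _).inter (measurableSet_isRenewal' _)) measurable_const measurable_const

open Classical in
/-- The event that slot `t` is the `g`-th renewal with backlogs in `U`, apart from slot `t` itself
being a renewal, is determined by the history before slot `t`. -/
theorem exists_past_event (S : Network N Z W A M) (r : RenewalRule Z W A) (g t : ℕ)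
    {U : Set ((N → ℝ) × (Fin M → ℝ))} (hU : MeasurableSet U) :
    ∃ H : Set (Fin t → Slot Z W A), MeasurableSet H ∧ ∀ path, past t path ∈ H ↔
      Nat.count (S.IsRenewal r path) t = g ∧
        (fun n => S.level (.inl n) t path, fun m => S.level (.inr m) t path) ∈ U := by
  -- Measurability with respect to the σ-algebra of the past is what yields `H` as a set of
  -- histories.
  let m : MeasurableSpace (SamplePath Z W A) := MeasurableSpace.comap (past t) inferInstance
  have hX : ∀ s < t, Measurable[m] fun path : SamplePath Z W A => path s := fun s hs =>
    (measurable_pi_apply (⟨s, hs⟩ : Fin t)).comp (comap_measurable (past t))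
  have h1 : MeasurableSet[m] ((fun path => Nat.count (S.IsRenewal r path) t) ⁻¹' {g}) :=
    (@measurable_count_isRenewal _ _ _ _ _ _ _ _ S r _ m (fun path => path) t _ hX)
      (measurableSet_singleton g)
  have h2 : Measurable[m] fun path => ((fun n => S.level (.inl n) t path : N → ℝ),
      (fun j => S.level (.inr j) t path : Fin M → ℝ)) :=
    (measurable_pi_lambda _ fun n =>
        @measurable_level _ _ _ _ _ _ _ _ S _ m (fun path => path) t (.inl n) hX).prodMk
      (measurable_pi_lambda _ fun j =>
        @measurable_level _ _ _ _ _ _ _ _ S _ m (fun path => path) t (.inr j) hX)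
  obtain ⟨H, hH, hH'⟩ := h1.inter (h2 hU)
  refine ⟨H, hH, fun path => ?_⟩
  change path ∈ past t ⁻¹' H ↔ _
  rw [hH']
  rfl

end Measurability

/-! ### The law of the sample paths and of the forced renewals. -/

section Law

variable {N Z W A : Type*} {M : ℕ}
  [MeasurableSpace Z] [MeasurableSpace W] [MeasurableSpace A]
  {S : Network N Z W A M}

instance (p : S.Policy) : IsProbabilityMeasure p.prob := by
  unfold Policy.prob
  infer_instance

theorem Policy.map_prob_zero (p : S.Policy) : p.prob.map (fun path => path 0) = p.init := by
  have h : p.prob.map (Preorder.frestrictLe (π := fun _ => Slot Z W A) 0)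
      = p.init.map (MeasurableEquiv.piUnique
          (fun _ : Finset.Iic 0 => Slot Z W A)).symm := by
    unfold Policy.prob Kernel.trajMeasure
    rw [Measure.map_comp _ _ (by fun_prop), Kernel.traj_map_frestrictLe,
      Kernel.partialTraj_self, Measure.id_comp]
  have h2 : (fun path : SamplePath Z W A => path 0)
      = (fun x : (Finset.Iic 0 → Slot Z W A) => x ⟨0, by simp⟩)
        ∘ Preorder.frestrictLe (π := fun _ => Slot Z W A) 0 := rfl
  rw [h2, ← Measure.map_map (by fun_prop) (by fun_prop), h,
    Measure.map_map (by fun_prop) (by fun_prop)]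
  exact Measure.map_id

theorem Policy.map_prob_succ (p : S.Policy) (t : ℕ) :
    p.prob.map (Preorder.frestrictLe (π := fun _ => Slot Z W A) t) ⊗ₘ p.step t
      = p.prob.map (fun path => (Preorder.frestrictLe (π := fun _ => Slot Z W A) t path,
          path (t + 1))) :=
  Kernel.map_frestrictLe_trajMeasure_compProd_eq_map_trajMeasure

theorem Policy.ae_step (p : S.Policy) (t : ℕ)
    {q : ((_i : Finset.Iic t) → Slot Z W A) × Slot Z W A → Prop} (hq : MeasurableSet {x | q x})
    (h : ∀ x, ∀ᵐ s ∂p.step t x, q (x, s)) :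
    ∀ᵐ path ∂p.prob, q (Preorder.frestrictLe (π := fun _ => Slot Z W A) t path, path (t + 1)) := by
  have h1 : ∀ᵐ x ∂(p.prob.map (Preorder.frestrictLe (π := fun _ => Slot Z W A) t) ⊗ₘ p.step t),
      q x := (Measure.ae_compProd_iff hq).2 (.of_forall h)
  rw [p.map_prob_succ] at h1
  exact (ae_map_iff (by fun_prop) hq).1 h1

theorem Policy.ae_feasible (p : S.Policy) : ∀ᵐ path ∂p.prob, S.Feasible path := by
  refine ae_all_iff.2 fun t => ?_
  cases t with
  | zero =>
    have h : ∀ᵐ s ∂p.init, s.2 ∈ S.actions s.1 :=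
      (Measure.ae_compProd_iff S.measurableSet_actions).2
        (.of_forall fun s => p.feasible 0 _ s)
    rw [← p.map_prob_zero] at h
    exact (ae_map_iff (measurable_pi_apply 0).aemeasurable S.measurableSet_actions).1 h
  | succ t =>
    refine p.ae_step t (q := fun x => x.2.2 ∈ S.actions x.2.1)
      (measurable_snd S.measurableSet_actions) fun x => ?_
    exact (Kernel.ae_compProd_iff S.measurableSet_actions).2
      (.of_forall fun s => p.feasible (t + 1) _ s)

theorem Policy.ae_forced [MeasurableSingletonClass Z] (p : S.Policy) :
    ∀ᵐ path ∂p.prob, ∀ t, (path t).1.2.2 = true → (path (t + 1)).1.1 = S.zero := by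
  -- `forced` concerns available actions only, so availability is a premise here, discharged at the
  -- end by `ae_feasible`.
  have h : ∀ t, ∀ᵐ path ∂p.prob, (path t).2 ∈ S.actions (path t).1 → (path t).1.2.2 = true →
      (path (t + 1)).1.1 = S.zero := by
    intro t
    let e : ((_i : Finset.Iic t) → Slot Z W A) → Slot Z W A :=
      fun x => x ⟨t, Finset.mem_Iic.2 le_rfl⟩
    have he : Measurable e := measurable_pi_apply _
    refine p.ae_step t (q := fun x => (e x.1).2 ∈ S.actions (e x.1).1 → (e x.1).1.2.2 = true →
      x.2.1.1 = S.zero) ?_ fun x => ?_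
    · have h1 : MeasurableSet {x : ((_i : Finset.Iic t) → Slot Z W A) × Slot Z W A |
          (e x.1).2 ∈ S.actions (e x.1).1} := (he.comp measurable_fst) S.measurableSet_actions
      have h2 : MeasurableSet {x : ((_i : Finset.Iic t) → Slot Z W A) × Slot Z W A |
          (e x.1).1.2.2 = true} :=
        (measurable_snd.comp (measurable_snd.comp (measurable_fst.comp
          (he.comp measurable_fst)))) (measurableSet_singleton true)
      have h3 : MeasurableSet {x : ((_i : Finset.Iic t) → Slot Z W A) × Slot Z W A |
          x.2.1.1 = S.zero} :=
        (measurable_fst.comp (measurable_fst.comp measurable_snd))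
          (measurableSet_singleton S.zero)
      exact h1.imp (h2.imp h3)
    · by_cases h1 : (e x).2 ∈ S.actions (e x).1
      swap
      · exact .of_forall fun s hs => absurd hs h1
      by_cases h2 : (e x).1.2.2 = true
      swap
      · exact .of_forall fun s _ hs => absurd hs h2
      have h3 : S.trans (e x) = Measure.dirac S.zero := by
        have h4 : e x = (((e x).1.1, ((e x).1.2.1, true)), (e x).2) := by rw [← h2]
        rw [h4]
        refine S.forced _ _ _ ?_
        rw [← h2]
        exact h1
      have h5 : ∀ᵐ y ∂(S.trans.comap e he ×ₖ Kernel.const _ S.outcomeLaw) x, y.1 = S.zero := by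
        rw [Kernel.prod_apply, Kernel.comap_apply, h3]
        refine Measure.quasiMeasurePreserving_fst.ae (p := fun z => z = S.zero) ?_
        exact (ae_dirac_iff (measurableSet_singleton S.zero)).2 rfl
      have h6 : ∀ᵐ s ∂p.step t x, s.1.1 = S.zero := by
        refine (Kernel.ae_compProd_iff ?_).2 (h5.mono fun y hy => .of_forall fun _ => hy)
        exact (measurable_fst.comp measurable_fst) (measurableSet_singleton S.zero)
      exact h6.mono fun s hs _ _ => hs
  filter_upwards [ae_all_iff.2 h, p.ae_feasible] with path h1 h2 t
  exact h1 t (h2 t)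

theorem outcomeLaw_false (S : Network N Z W A M) :
    S.outcomeLaw {o | o.2 = false} = ENNReal.ofReal (1 - S.phi) := by
  classical
  have h : {o : W × Bool | o.2 = false} = Set.univ ×ˢ {false} := by
    ext; simp
  rw [h, outcomeLaw, Measure.prod_prod, bernoulliMeasure_apply _ (measurableSet_singleton _)]
  simp [ENNReal.ofReal]
  ext
  simp [S.phi.2.2]

theorem measurableSet_noForced : MeasurableSet {s : Slot Z W A | s.1.2.2 = false} :=
  (measurable_snd.comp (measurable_snd.comp measurable_fst)) (measurableSet_singleton false)

theorem Policy.init_false (p : S.Policy) :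
    p.init {s | s.1.2.2 = false} = ENNReal.ofReal (1 - S.phi) := by
  have h : p.init.fst.snd = S.outcomeLaw := by
    unfold Policy.init
    rw [Measure.fst_compProd, Measure.snd_prod]
  have hm : MeasurableSet {o : W × Bool | o.2 = false} :=
    measurable_snd (measurableSet_singleton false)
  rw [← outcomeLaw_false, ← h, Measure.snd_apply hm, Measure.fst_apply (measurable_snd hm)]
  rfl

/-- The outcome is drawn from a constant kernel before the action is chosen, so its marginal does
not see the history. -/
theorem Policy.step_false (p : S.Policy) (t : ℕ) (x : (_i : Finset.Iic t) → Slot Z W A) :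
    p.step t x {s | s.1.2.2 = false} = ENNReal.ofReal (1 - S.phi) := by
  have h : (p.step t).fst.snd = Kernel.const _ S.outcomeLaw := by
    unfold Policy.step
    rw [Kernel.fst_compProd, Kernel.snd_prod]
  have hm : MeasurableSet {o : W × Bool | o.2 = false} :=
    measurable_snd (measurableSet_singleton false)
  have h2 : (p.step t).fst.snd x {o | o.2 = false} = S.outcomeLaw {o | o.2 = false} := by
    rw [h, Kernel.const_apply]
  rw [← outcomeLaw_false, ← h2, Kernel.snd_apply' _ _ hm,
    Kernel.fst_apply' _ _ (measurable_snd hm)]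
  rfl

/-- In the first `k` slots there is no forced renewal with probability `(1 - φ) ^ k`. -/
theorem Policy.prob_noForced (p : S.Policy) (k : ℕ) :
    p.prob {path | ∀ s < k, (path s).1.2.2 = false} = ENNReal.ofReal (1 - S.phi) ^ k := by
  induction k with
  | zero => simp
  | succ k ih =>
    cases k with
    | zero =>
      rw [← p.init_false, ← p.map_prob_zero, Measure.map_apply (by fun_prop) measurableSet_noForced]
      simp
    | succ t =>
      let G : Set ((_i : Finset.Iic t) → Slot Z W A) := {x | ∀ i, (x i).1.2.2 = false}
      have hG : MeasurableSet G := by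
        have : G = ⋂ i, {x | (x i).1.2.2 = false} := by ext; simp [G]
        rw [this]
        exact MeasurableSet.iInter fun i =>
            (measurable_pi_apply (X := fun _ => Slot Z W A) i) measurableSet_noForced
      have h1 : {path : SamplePath Z W A | ∀ s < t + 1, (path s).1.2.2 = false}
          = Preorder.frestrictLe (π := fun _ => Slot Z W A) t ⁻¹' G := by
        ext path
        simp [G]
      have h2 : {path : SamplePath Z W A | ∀ s < t + 1 + 1, (path s).1.2.2 = false}
          = (fun path => (Preorder.frestrictLe (π := fun _ => Slot Z W A) t path, path (t + 1)))
            ⁻¹' (G ×ˢ {s | s.1.2.2 = false}) := by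
        ext path
        simp only [Set.mem_ofPred_eq, Set.mem_preimage, Set.mem_prod, Nat.lt_succ_iff, G,
          Preorder.frestrictLe_apply, Subtype.forall, Finset.mem_Iic]
        constructor
        · exact fun h => ⟨fun a ha => h a (by omega), h _ le_rfl⟩
        · rintro ⟨h, h'⟩ s hs
          rcases Nat.le_succ_iff.1 hs with hs | rfl
          exacts [h s hs, h']
      -- Splitting off the last slot, its outcome contributes the constant factor `1 - φ` whatever
      -- the history.
      rw [h2, ← Measure.map_apply (by fun_prop) (hG.prod measurableSet_noForced),
        ← p.map_prob_succ, Measure.compProd_apply_prod hG measurableSet_noForced]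
      simp only [p.step_false, lintegral_const, MeasurableSet.univ, Measure.restrict_apply,
        Set.univ_inter]
      rw [Measure.map_apply (by fun_prop) hG, ← h1, ih, pow_succ _ (t + 1), mul_comm]

end Law

end Network

/-! ### Conditional moments of the renewal intervals and integrability. -/

theorem condExp_le_const_of_setIntegral_le {Ω : Type*} {m m0 : MeasurableSpace Ω} {μ : Measure Ω}
    [IsFiniteMeasure μ] (hm : m ≤ m0) {f : Ω → ℝ} (hf : Integrable f μ) {c : ℝ}
    (h : ∀ F, MeasurableSet[m] F → ∫ x in F, f x ∂μ ≤ c * μ.real F) :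
    μ[f | m] ≤ᵐ[μ] fun _ => c := by
  refine ae_le_of_ae_le_trim (hm := hm) ?_
  refine ae_le_of_forall_setIntegral_le
    (integrable_condExp.trim hm stronglyMeasurable_condExp) (integrable_const c) fun F hF _ => ?_
  rw [← setIntegral_trim hm stronglyMeasurable_condExp hF, setIntegral_condExp hm hf hF]
  refine (h F hF).trans_eq ?_
  simp [measureReal_def, trim_measurableSet_eq hm hF, mul_comm]

namespace Network

variable {N Z W A : Type*} {M : ℕ}
  [MeasurableSpace Z] [MeasurableSingletonClass Z] [MeasurableSpace W] [MeasurableSpace A]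
  {S : Network N Z W A M} {r : RenewalRule Z W A}

namespace RenewalRequirements

theorem ae_regular (hr : S.RenewalRequirements r) (p : S.Policy) :
    ∀ᵐ path ∂p.prob, S.Regular r path := by
  obtain ⟨m₁, m₂, h⟩ := hr.moments
  have h1 : ∀ t, ∀ᵐ path ∂p.prob, S.IsRenewal r path t → S.timeToRenewal r t path < ∞ := by
    intro t
    have h2 := (h p t Set.univ MeasurableSet.univ).1
    simp only [Set.mem_univ, and_true] at h2
    refine (ae_restrict_iff' (measurableSet_isRenewal' t)).1
      (ae_lt_top (measurable_timeToRenewal S r t) (ne_top_of_le_ne_top ?_ h2))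
    exact ENNReal.mul_ne_top ENNReal.coe_ne_top (measure_ne_top _ _)
  filter_upwards [p.ae_feasible, ae_all_iff.2 h1] with path h2 h3
  exact ⟨h2, infinite_renewals h3⟩

/-- The required moment bounds concern a fixed slot, while the `g`-th renewal falls on a random one.
Splitting by its slot `t`, `exists_past_event` turns each piece into an event of the required form,
and the bounds add up. -/
theorem setLIntegral_renewalLength_le (hr : S.RenewalRequirements r) {k : ℕ} {c : ℝ≥0}
    {p : S.Policy}
    (hc : ∀ (t : ℕ) (H : Set (Fin t → Slot Z W A)), MeasurableSet H →
      ∫⁻ path in {path | S.IsRenewal r path t ∧ past t path ∈ H},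
          S.timeToRenewal r t path ^ k ∂p.prob
        ≤ c * p.prob {path | S.IsRenewal r path t ∧ past t path ∈ H})
    (g : ℕ) {F : Set (SamplePath Z W A)} (hF : MeasurableSet[S.backlogSigma r g] F) :
    ∫⁻ path in F, (S.renewalLength r g path : ℝ≥0∞) ^ k ∂p.prob ≤ c * p.prob F := by
  classical
  obtain ⟨U, hU, rfl⟩ := hF
  choose H hH hH' using fun t => exists_past_event S r g t hU
  set F : ℕ → Set (SamplePath Z W A) := fun t =>
    S.backlog r g ⁻¹' U ∩ S.renewalTime r g ⁻¹' {t} with hFdef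
  have hFm : ∀ t, MeasurableSet (F t) := fun t =>
    (measurable_backlog S r g hU).inter
      (measurable_renewalTime S r g (measurableSet_singleton t))
  have hFd : Pairwise (Function.onFun Disjoint F) := by
    intro s t hst
    refine Set.disjoint_left.2 fun path h1 h2 => hst ?_
    exact h1.2.symm.trans h2.2
  have hFU : ⋃ t, F t = S.backlog r g ⁻¹' U := by
    rw [hFdef, ← Set.inter_iUnion]
    exact Set.inter_eq_left.2 fun path _ => Set.mem_iUnion.2 ⟨_, rfl⟩
  -- The sets agree only almost surely: with finitely many renewals, `renewalTime` may be the
  -- default 0.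
  have hFE : ∀ t, F t =ᵐ[p.prob] {path | S.IsRenewal r path t ∧ past t path ∈ H t} := by
    intro t
    filter_upwards [hr.ae_regular p] with path hpath
    refine propext ?_
    change (S.backlog r g path ∈ U ∧ S.renewalTime r g path = t) ↔
      (S.IsRenewal r path t ∧ past t path ∈ H t)
    rw [hH']
    constructor
    · rintro ⟨h1, rfl⟩
      exact ⟨hpath.isRenewal_renewalTime g, Nat.count_nth_of_infinite hpath.infinite g, h1⟩
    · rintro ⟨h1, h2, h3⟩
      have h4 : S.renewalTime r g path = t := by
        rw [← h2]
        exact Nat.nth_count h1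
      refine ⟨?_, h4⟩
      change ((fun n => S.level (.inl n) (S.renewalTime r g path) path),
        fun j => S.level (.inr j) (S.renewalTime r g path) path) ∈ U
      rwa [h4]
  rw [← hFU, lintegral_iUnion hFm hFd, measure_iUnion hFd hFm, ← ENNReal.tsum_mul_left]
  refine ENNReal.tsum_le_tsum fun t => ?_
  calc ∫⁻ path in F t, (S.renewalLength r g path : ℝ≥0∞) ^ k ∂p.prob
      = ∫⁻ path in F t, S.timeToRenewal r t path ^ k ∂p.prob := by
        refine setLIntegral_congr_fun_ae (hFm t) ?_
        filter_upwards [hr.ae_regular p] with path hpath hmem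
        rw [← hpath.timeToRenewal_renewalTime, show S.renewalTime r g path = t from hmem.2]
    _ ≤ c * p.prob (F t) := by
        rw [setLIntegral_congr (hFE t), measure_congr (hFE t)]
        exact hc t (H t) (hH t)

/-- The moments of the renewal intervals, given the backlogs at their starts, are bounded. -/
theorem exists_moment_bounds (hr : S.RenewalRequirements r) :
    ∃ m₁ m₂ : ℝ, 0 ≤ m₁ ∧ 0 ≤ m₂ ∧ ∀ (p : S.Policy) (g : ℕ),
      MemLp (fun path => (S.renewalLength r g path : ℝ)) 2 p.prob ∧
      (p.prob[fun path => (S.renewalLength r g path : ℝ) | S.backlogSigma r g]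
        ≤ᵐ[p.prob] fun _ => m₁) ∧
      (p.prob[fun path => (S.renewalLength r g path : ℝ) ^ 2 | S.backlogSigma r g]
        ≤ᵐ[p.prob] fun _ => m₂) := by
  obtain ⟨m₁, m₂, h⟩ := hr.moments
  -- The constants precede the policy; this uniformity later bounds the shortest path problem from
  -- below.
  refine ⟨m₁, m₂, m₁.2, m₂.2, fun p g => ?_⟩
  have hmeas : Measurable fun path => (S.renewalLength r g path : ℝ) :=
    measurable_from_top.comp (measurable_renewalLength S r g)
  have key : ∀ (k : ℕ) (c : ℝ≥0),
      (∀ (t : ℕ) (H : Set (Fin t → Slot Z W A)), MeasurableSet H →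
        ∫⁻ path in {path | S.IsRenewal r path t ∧ past t path ∈ H},
            S.timeToRenewal r t path ^ k ∂p.prob
          ≤ c * p.prob {path | S.IsRenewal r path t ∧ past t path ∈ H}) →
      Integrable (fun path => (S.renewalLength r g path : ℝ) ^ k) p.prob ∧
      (p.prob[fun path => (S.renewalLength r g path : ℝ) ^ k | S.backlogSigma r g]
        ≤ᵐ[p.prob] fun _ => (c : ℝ)) := by
    intro k c hc
    have h1 := fun F hF => hr.setLIntegral_renewalLength_le hc g (F := F) hF
    have h2 : ∀ path : SamplePath Z W A, ENNReal.ofReal ((S.renewalLength r g path : ℝ) ^ k)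
        = (S.renewalLength r g path : ℝ≥0∞) ^ k := by
      intro path
      rw [ENNReal.ofReal_pow (Nat.cast_nonneg _), ENNReal.ofReal_natCast]
    have h3 : Integrable (fun path => (S.renewalLength r g path : ℝ) ^ k) p.prob := by
      refine (lintegral_ofReal_ne_top_iff_integrable (hmeas.pow_const k).aestronglyMeasurable
        (.of_forall fun path => by positivity)).1 ?_
      simp only [h2]
      have h4 := h1 Set.univ MeasurableSet.univ
      rw [setLIntegral_univ] at h4
      exact ne_top_of_le_ne_top (ENNReal.mul_ne_top ENNReal.coe_ne_top (measure_ne_top _ _)) h4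
    refine ⟨h3, condExp_le_const_of_setIntegral_le (backlogSigma_le S r g) h3 fun F hF => ?_⟩
    rw [integral_eq_lintegral_of_nonneg_ae (.of_forall fun path => by positivity)
      (hmeas.pow_const k).aestronglyMeasurable]
    simp only [h2]
    refine (ENNReal.toReal_mono ?_ (h1 F hF)).trans_eq ?_
    · exact ENNReal.mul_ne_top ENNReal.coe_ne_top (measure_ne_top _ _)
    · rw [ENNReal.toReal_mul]
      rfl
  have h1 := key 1 m₁ fun t H hH => by simpa only [pow_one] using (h p t H hH).1
  have h2 := key 2 m₂ fun t H hH => (h p t H hH).2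
  refine ⟨(memLp_two_iff_integrable_sq hmeas.aestronglyMeasurable).2 h2.1, ?_, h2.2⟩
  simpa only [pow_one] using h1.2

variable (hr : S.RenewalRequirements r)
include hr

theorem memLp_renewalLength (p : S.Policy) (g : ℕ) :
    MemLp (fun path => (S.renewalLength r g path : ℝ)) 2 p.prob := by
  obtain ⟨m₁, m₂, -, -, h⟩ := hr.exists_moment_bounds
  exact (h p g).1

/-- A backlog grows at most linearly in time, and t_g is a sum of `g` square integrable interval
lengths. -/
theorem memLp_level (p : S.Policy) (i : N ⊕ Fin M) (g : ℕ) :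
    MemLp (fun path => S.level i (S.renewalTime r g path) path) 2 p.prob := by
  have h1 : MemLp (fun path => S.stepMax i *
      ∑ k ∈ Finset.range g, (S.renewalLength r k path : ℝ)) 2 p.prob :=
    (memLp_finsetSum _ fun k _ => hr.memLp_renewalLength p k).const_mul _
  refine h1.mono (measurable_level_renewalTime i g).aestronglyMeasurable ?_
  filter_upwards [hr.ae_regular p] with path hpath
  rw [Real.norm_eq_abs, Real.norm_eq_abs, abs_of_nonneg (level_nonneg hpath.feasible i _)]
  refine le_trans ?_ (le_abs_self _)
  refine (level_le hpath.feasible i _).trans_eq ?_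
  rw [hpath.renewalTime_eq_sum]
  push_cast
  ring

theorem memLp_renewalSum (p : S.Policy) {f : Slot Z W A → ℝ} (hfm : Measurable f) {K : ℝ}
    (hf : ∀ s : Slot Z W A, s.2 ∈ S.actions s.1 → |f s| ≤ K) (g : ℕ) :
    MemLp (S.renewalSum r f g) 2 p.prob := by
  refine ((hr.memLp_renewalLength p g).const_mul K).mono
    (measurable_renewalSum hfm g).aestronglyMeasurable ?_
  filter_upwards [hr.ae_regular p] with path hpath
  exact (abs_renewalSum_le hpath.feasible hf g).trans (le_abs_self _)

theorem memLp_renewalSum_increment (p : S.Policy) (i : N ⊕ Fin M) (g : ℕ) :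
    MemLp (S.renewalSum r (S.increment i) g) 2 p.prob :=
  hr.memLp_renewalSum p (measurable_increment S i) (fun _ h => abs_increment_le h i) g

/-- The pull-out property for a backlog at the start of a renewal interval. -/
theorem integral_level_mul_condExp (p : S.Policy) (i : N ⊕ Fin M) (g : ℕ)
    {X : SamplePath Z W A → ℝ} (hX : MemLp X 2 p.prob) :
    Integrable (fun path => S.level i (S.renewalTime r g path) path
      * (p.prob[X | S.backlogSigma r g]) path) p.prob ∧
    ∫ path, S.level i (S.renewalTime r g path) path
      * (p.prob[X | S.backlogSigma r g]) path ∂p.prob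
      = ∫ path, S.level i (S.renewalTime r g path) path * X path ∂p.prob := by
  have h1 : Integrable ((fun path => S.level i (S.renewalTime r g path) path) * X) p.prob :=
    (hr.memLp_level p i g).integrable_mul hX
  have h2 := condExp_mul_of_stronglyMeasurable_left
    (measurable_backlogSigma_level (r := r) i g).stronglyMeasurable h1
    (hX.integrable (by norm_num))
  refine ⟨integrable_condExp.congr h2, ?_⟩
  rw [← integral_condExp (backlogSigma_le S r g) (f := fun path =>
    S.level i (S.renewalTime r g path) path * X path)]
  exact (integral_congr_ae h2).symm

end RenewalRequirements

end Network

/-! ### The Lyapunov drift over a renewal interval. -/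

namespace Network

variable {N Z W A : Type*} [Fintype N] {M : ℕ}
  [MeasurableSpace Z] [MeasurableSingletonClass Z] [MeasurableSpace W] [MeasurableSpace A]
  {S : Network N Z W A M} {r : RenewalRule Z W A}

-- The sign stays inside the conditional expectation: the conditioned functions are then literally
-- equal, and the identity holds at every path instead of almost everywhere.
omit [MeasurableSingletonClass Z] in
theorem driftBound_eq_sum (p : S.Policy) (g : ℕ) (path : SamplePath Z W A) :
    S.driftBound r p g path = -∑ i, S.level i (S.renewalTime r g path) path *
      (p.prob[fun path => -S.renewalSum r (S.increment i) g path | S.backlogSigma r g]) path := by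
  simp only [driftBound, Fintype.sum_sum_type, renewalSum_increment_inl,
    renewalSum_increment_inr, neg_neg, backlog_fst, backlog_snd]
  ring

omit [MeasurableSingletonClass Z] in
theorem shortestPathValue_eq (q : N → ℝ) (y : Fin M → ℝ) :
    S.shortestPathValue r q y = ⨅ p : S.Policy, ∑ i,
      Sum.elim q y i * ∫ path, S.renewalSum r (S.increment i) 0 path ∂p.prob := by
  unfold shortestPathValue
  congr 1 with p
  simp only [Fintype.sum_sum_type, Sum.elim_inl, Sum.elim_inr, renewalSum_increment_inl,
    renewalSum_increment_inr, integral_neg, mul_neg, Finset.sum_neg_distrib]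
  ring

namespace RenewalRequirements

variable (hr : S.RenewalRequirements r)
include hr

theorem integral_driftBound (p : S.Policy) (g : ℕ) :
    Integrable (S.driftBound r p g) p.prob ∧
    ∫ path, S.driftBound r p g path ∂p.prob = ∑ i, ∫ path,
      S.level i (S.renewalTime r g path) path * S.renewalSum r (S.increment i) g path ∂p.prob := by
  have h := fun i => hr.integral_level_mul_condExp p i g
    (X := fun path => -S.renewalSum r (S.increment i) g path)
    (hr.memLp_renewalSum_increment p i g).neg
  have h1 : S.driftBound r p g = fun path => -∑ i, S.level i (S.renewalTime r g path) path *
      (p.prob[fun path => -S.renewalSum r (S.increment i) g path | S.backlogSigma r g]) path :=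
    funext fun path => driftBound_eq_sum p g path
  rw [h1]
  refine ⟨(integrable_finsetSum _ fun i _ => (h i).1).neg, ?_⟩
  rw [integral_neg, integral_finsetSum _ fun i _ => (h i).1, ← Finset.sum_neg_distrib]
  refine Finset.sum_congr rfl fun i _ => ?_
  rw [(h i).2, ← integral_neg]
  simp

/-- A policy gives an upper bound of the shortest path value. -/
theorem shortestPathValue_le (q : N → ℝ) (y : Fin M → ℝ) (p : S.Policy) :
    S.shortestPathValue r q y ≤ ∑ i,
      Sum.elim q y i * ∫ path, S.renewalSum r (S.increment i) 0 path ∂p.prob := by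
  rw [shortestPathValue_eq]
  -- A real infimum is 0 for a family unbounded below, so a lower bound over all policies is needed;
  -- it comes from the uniform first moment `m₁`.
  refine ciInf_le ?_ p
  obtain ⟨m₁, m₂, hm₁, hm₂, h⟩ := hr.exists_moment_bounds
  refine ⟨-∑ i, |Sum.elim q y i| * (S.stepMax i * m₁), ?_⟩
  rintro _ ⟨p, rfl⟩
  rw [← Finset.sum_neg_distrib]
  refine Finset.sum_le_sum fun i _ => ?_
  have hT : Integrable (fun path => (S.renewalLength r 0 path : ℝ)) p.prob :=
    (h p 0).1.integrable (by norm_num)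
  have h1 : |∫ path, S.renewalSum r (S.increment i) 0 path ∂p.prob| ≤ S.stepMax i * m₁ := by
    refine abs_integral_le_integral_abs.trans ?_
    calc ∫ path, |S.renewalSum r (S.increment i) 0 path| ∂p.prob
        ≤ ∫ path, S.stepMax i * (S.renewalLength r 0 path : ℝ) ∂p.prob := by
          refine integral_mono_ae
            ((hr.memLp_renewalSum_increment p i 0).integrable (by norm_num)).abs
            (hT.const_mul _) ?_
          filter_upwards [hr.ae_regular p] with path hpath
          exact abs_renewalSum_le hpath.feasible (fun s hs => abs_increment_le hs i) 0
      _ = S.stepMax i * ∫ path, (S.renewalLength r 0 path : ℝ) ∂p.prob := integral_const_mul _ _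
      _ ≤ S.stepMax i * m₁ := by
          refine mul_le_mul_of_nonneg_left ?_ (S.stepMax_nonneg i)
          rw [← integral_condExp (backlogSigma_le S r 0)]
          refine (integral_mono_ae integrable_condExp (integrable_const _) (h p 0).2.1).trans_eq ?_
          simp
  have h2 := mul_le_mul_of_nonneg_left h1 (abs_nonneg (Sum.elim q y i))
  rw [← abs_mul] at h2
  linarith [neg_abs_le (Sum.elim q y i * ∫ path, S.renewalSum r (S.increment i) 0 path ∂p.prob)]

omit [Fintype N] in
theorem integral_renewalSum_increment_le {ε : ℝ} {p : S.StationaryPolicy}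
    (hslack : S.HasSlack r p ε) (hpos : 0 < S.meanLength r p.toPolicy) (i : N ⊕ Fin M) :
    ∫ path, S.renewalSum r (S.increment i) 0 path ∂p.toPolicy.prob
      ≤ -(ε * S.meanLength r p.toPolicy) := by
  rcases i with n | m
  · have h1 := (le_div_iff₀ hpos).1 (hslack.2 n)
    simp only [renewalSum_increment_inl, integral_neg]
    linarith
  · have h1 := (div_le_iff₀ hpos).1 (hslack.1 m)
    have hT : Integrable (fun path => (S.renewalLength r 0 path : ℝ)) p.toPolicy.prob :=
      (hr.memLp_renewalLength p.toPolicy 0).integrable (by norm_num)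
    have hI : Integrable (S.renewalSum r (S.increment (.inr m)) 0) p.toPolicy.prob :=
      (hr.memLp_renewalSum_increment p.toPolicy (.inr m) 0).integrable (by norm_num)
    have h2 : S.renewalSum r (S.penalty m.succ) 0 = fun path =>
        S.renewalSum r (S.increment (.inr m)) 0 path + S.renewalLength r 0 path * S.target m := by
      ext path
      rw [renewalSum_increment_inr, penaltySlack]
      ring
    have h3 : ∫ path, S.renewalSum r (S.penalty m.succ) 0 path ∂p.toPolicy.prob
        = ∫ path, S.renewalSum r (S.increment (.inr m)) 0 path ∂p.toPolicy.prob
          + S.meanLength r p.toPolicy * S.target m := by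
      rw [h2, integral_add hI (hT.mul_const _), integral_mul_const]
      rfl
    rw [h3] at h1
    linarith

theorem shortestPathValue_le_of_hasSlack {ε : ℝ} {p : S.StationaryPolicy}
    (hslack : S.HasSlack r p ε) (hpos : 0 < S.meanLength r p.toPolicy)
    {q : N → ℝ} {y : Fin M → ℝ} (hq : ∀ n, 0 ≤ q n) (hy : ∀ m, 0 ≤ y m) :
    S.shortestPathValue r q y ≤ -(ε * S.meanLength r p.toPolicy) * (∑ n, q n + ∑ m, y m) := by
  refine (hr.shortestPathValue_le q y p.toPolicy).trans ?_
  have h1 : ∑ n, q n + ∑ m, y m = ∑ i, Sum.elim q y i := by simp [Fintype.sum_sum_type]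
  rw [h1, Finset.mul_sum]
  refine Finset.sum_le_sum fun i _ => ?_
  rw [mul_comm (-_)]
  refine mul_le_mul_of_nonneg_left (hr.integral_renewalSum_increment_le hslack hpos i) ?_
  rcases i with n | m
  exacts [hq n, hy m]

omit [Fintype N] in
/-- The second moments of the renewal intervals are controlled by `driftConst`. -/
theorem sigmaSq_mul_integral_le (p : S.Policy) {sigmaSq : ℝ} (hσ : 0 ≤ sigmaSq) (g : ℕ) :
    sigmaSq * ∫ path, (S.renewalLength r g path : ℝ) ^ 2 ∂p.prob
      ≤ 2 * S.driftConst r p sigmaSq := by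
  obtain ⟨m₁, m₂, hm₁, hm₂, h⟩ := hr.exists_moment_bounds
  set E : ℕ → SamplePath Z W A → ℝ := fun g =>
    p.prob[fun path => (S.renewalLength r g path : ℝ) ^ 2 | S.backlogSigma r g] with hE
  have h0 : ∀ g, 0 ≤ᵐ[p.prob] E g := fun g =>
    condExp_nonneg (.of_forall fun path => sq_nonneg _)
  -- In `ℝ`, `essSup` and `⨆` are meaningful only for bounded families; the bounds 0 and `m₂` secure
  -- this.
  have hco : ∀ g, IsCoboundedUnder (· ≤ ·) (ae p.prob) (E g) := fun g =>
    IsBoundedUnder.isCoboundedUnder_le ⟨0, h0 g⟩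
  have hbdd : BddAbove (Set.range fun g => essSup (E g) p.prob) := by
    refine ⟨m₂, ?_⟩
    rintro _ ⟨g, rfl⟩
    exact essSup_le_of_ae_le m₂ (h p g).2.2 (hco g)
  have h1 : ∫ path, (S.renewalLength r g path : ℝ) ^ 2 ∂p.prob
      ≤ ⨆ g, essSup (E g) p.prob := by
    rw [← integral_condExp (backlogSigma_le S r g)]
    refine (integral_mono_ae integrable_condExp (integrable_const _)
      (ae_le_essSup (μ := p.prob) (f := E g) ⟨m₂, (h p g).2.2⟩)).trans ?_
    simpa using le_ciSup hbdd g
  have h2 := mul_le_mul_of_nonneg_left h1 hσ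
  unfold driftConst
  linarith

/-- The change of the Lyapunov function over a renewal interval. -/
theorem integral_sq_succ_le (p : S.Policy) {sigmaSq : ℝ} (hsigma : S.IsSlotBound p sigmaSq)
    (g : ℕ) :
    ∑ i, ∫ path, S.level i (S.renewalTime r (g + 1) path) path ^ 2 ∂p.prob
      ≤ ∑ i, ∫ path, S.level i (S.renewalTime r g path) path ^ 2 ∂p.prob
        + 2 * ∫ path, S.driftBound r p g path ∂p.prob + 2 * S.driftConst r p sigmaSq := by
  have hσ : 0 ≤ sigmaSq := by
    obtain ⟨path, hpath⟩ := Eventually.exists hsigma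
    refine le_trans ?_ (hpath 0)
    positivity
  have hsq := fun i g => (hr.memLp_level p i g).integrable_sq
  have hmul : ∀ i, Integrable (fun path => S.level i (S.renewalTime r g path) path
      * S.renewalSum r (S.increment i) g path) p.prob := fun i =>
    (hr.memLp_level p i g).integrable_mul (hr.memLp_renewalSum_increment p i g)
  have hT := (hr.memLp_renewalLength p g).integrable_sq
  have h1 : (fun path => ∑ i, S.level i (S.renewalTime r (g + 1) path) path ^ 2)
      ≤ᵐ[p.prob] fun path => ∑ i, S.level i (S.renewalTime r g path) path ^ 2
        + 2 * (∑ i, S.level i (S.renewalTime r g path) path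
            * S.renewalSum r (S.increment i) g path)
        + sigmaSq * (S.renewalLength r g path : ℝ) ^ 2 := by
    filter_upwards [hr.ae_regular p, hsigma] with path hpath hs
    -- The slot bound controls the sum over the queues in one slot, so the two sums are exchanged.
    have h2 : ∑ i, S.renewalSum r (S.squareTerm i) g path
        ≤ sigmaSq * S.renewalLength r g path := by
      unfold renewalSum
      rw [Finset.sum_comm]
      refine (Finset.sum_le_sum fun τ _ => ?_).trans_eq
        (by rw [Finset.sum_const, Finset.card_range, nsmul_eq_mul, mul_comm])
      rw [Fintype.sum_sum_type]
      exact hs _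
    have h3 := Finset.sum_le_sum fun i (_ : i ∈ Finset.univ) =>
      hpath.level_renewalTime_succ_sq_le i g
    simp only [Finset.sum_add_distrib, mul_assoc, ← Finset.mul_sum] at h3
    have h4 := mul_le_mul_of_nonneg_left h2 (Nat.cast_nonneg (α := ℝ) (S.renewalLength r g path))
    nlinarith
  have hA : Integrable (fun path => ∑ i, S.level i (S.renewalTime r g path) path ^ 2) p.prob :=
    integrable_finsetSum _ fun i _ => hsq i g
  have hB : Integrable (fun path => 2 * ∑ i, S.level i (S.renewalTime r g path) path
      * S.renewalSum r (S.increment i) g path) p.prob :=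
    (integrable_finsetSum _ fun i _ => hmul i).const_mul 2
  have hAB : Integrable (fun path => ∑ i, S.level i (S.renewalTime r g path) path ^ 2
      + 2 * ∑ i, S.level i (S.renewalTime r g path) path
      * S.renewalSum r (S.increment i) g path) p.prob := hA.add hB
  have h5 := integral_mono_ae (integrable_finsetSum _ fun i _ => hsq i (g + 1))
    (hAB.add (hT.const_mul sigmaSq)) h1
  simp only [Pi.add_apply] at h5
  rw [integral_add hAB (hT.const_mul sigmaSq), integral_add hA hB,
    integral_const_mul, integral_const_mul,
    integral_finsetSum _ fun i _ => hsq i (g + 1), integral_finsetSum _ fun i _ => hsq i g,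
    integral_finsetSum _ fun i _ => hmul i] at h5
  rw [(hr.integral_driftBound p g).2]
  linarith [hr.sigmaSq_mul_integral_le p hσ g]

omit [Fintype N] in
theorem integrable_level (p : S.Policy) (i : N ⊕ Fin M) (g : ℕ) :
    Integrable (fun path => S.level i (S.renewalTime r g path) path) p.prob :=
  (hr.memLp_level p i g).integrable (by norm_num)

theorem integral_driftBound_le {ε C δ : ℝ} {pStar : S.StationaryPolicy}
    (hslack : S.HasSlack r pStar ε) (hpos : 0 < S.meanLength r pStar.toPolicy) {p : S.Policy}
    (happrox : S.ApproxShortestPath r p C δ) (g : ℕ) :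
    ∫ path, S.driftBound r p g path ∂p.prob ≤ C - (ε * S.meanLength r pStar.toPolicy - δ)
      * ∑ i, ∫ path, S.level i (S.renewalTime r g path) path ∂p.prob := by
  have hint := fun i => hr.integrable_level p i g
  have hsum := integrable_finsetSum Finset.univ fun i _ => hint i
  rw [← integral_finsetSum _ fun i _ => hint i, ← integral_const_mul]
  have h1 : ∫ path, (C - (ε * S.meanLength r pStar.toPolicy - δ)
      * ∑ i, S.level i (S.renewalTime r g path) path) ∂p.prob
      = C - ∫ path, (ε * S.meanLength r pStar.toPolicy - δ)
      * ∑ i, S.level i (S.renewalTime r g path) path ∂p.prob := by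
    rw [integral_sub (integrable_const _) (hsum.const_mul _)]
    simp
  rw [← h1]
  refine integral_mono_ae (hr.integral_driftBound p g).1
    ((integrable_const C).sub (hsum.const_mul _)) ?_
  filter_upwards [happrox g, hr.ae_regular p] with path h2 hpath
  have h3 := hr.shortestPathValue_le_of_hasSlack hslack hpos
    (q := (S.backlog r g path).1) (y := (S.backlog r g path).2)
    (fun n => level_nonneg hpath.feasible (.inl n) _)
    (fun m => level_nonneg hpath.feasible (.inr m) _)
  simp only [Fintype.sum_sum_type, ← backlog_fst, ← backlog_snd]
  linarith

theorem sum_integral_level_le {ε C δ : ℝ} {pStar : S.StationaryPolicy}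
    (hslack : S.HasSlack r pStar ε) (hδ : 0 ≤ δ) (hε : 0 < ε)
    (hδε : δ < ε * S.meanLength r pStar.toPolicy) {p : S.Policy}
    (happrox : S.ApproxShortestPath r p C δ) {sigmaSq : ℝ} (hsigma : S.IsSlotBound p sigmaSq)
    (G : ℕ) :
    ∑ g ∈ Finset.range G, ∑ i, ∫ path, S.level i (S.renewalTime r g path) path ∂p.prob
      ≤ G * ((S.driftConst r p sigmaSq + C) / (ε * S.meanLength r pStar.toPolicy - δ)) := by
  -- Positivity makes the ratios in `HasSlack` genuine quotients.
  have hpos : 0 < S.meanLength r pStar.toPolicy :=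
    pos_of_mul_pos_right (hδ.trans_lt hδε) hε.le
  have hκ : 0 < ε * S.meanLength r pStar.toPolicy - δ := sub_pos.2 hδε
  -- This is the telescoped drift inequality; it starts from 0 because all queues are empty at slot
  -- 0.
  have h1 : ∀ G : ℕ, ∑ i, ∫ path, S.level i (S.renewalTime r G path) path ^ 2 ∂p.prob
      + 2 * ((ε * S.meanLength r pStar.toPolicy - δ) * ∑ g ∈ Finset.range G,
        ∑ i, ∫ path, S.level i (S.renewalTime r g path) path ∂p.prob)
      ≤ 2 * (G * (S.driftConst r p sigmaSq + C)) := by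
    intro G
    induction G with
    | zero => simp
    | succ G ih =>
      have h2 := hr.integral_sq_succ_le p hsigma G
      have h3 := hr.integral_driftBound_le hslack hpos happrox G
      rw [Finset.sum_range_succ, mul_add]
      push_cast
      linarith
  have h4 : 0 ≤ ∑ i, ∫ path, S.level i (S.renewalTime r G path) path ^ 2 ∂p.prob :=
    Finset.sum_nonneg fun i _ => integral_nonneg fun path => sq_nonneg _
  rw [← mul_div_assoc, le_div_iff₀ hκ]
  linarith [h1 G]

end RenewalRequirements

end Network

/-- A large value `a t` persists, as `a` loses at most `b` per step. On a window of `n` slots this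
gives `n * a t ≤ K * (t + n) + n² * b`, and `n` of order `√t` makes `a t` of order `√t`. -/
theorem tendsto_div_atTop_of_sum_le {a : ℕ → ℝ} {b K : ℝ} (ha : ∀ t, 0 ≤ a t)
    (hstep : ∀ t, a t ≤ a (t + 1) + b) (hb : 0 ≤ b)
    (hsum : ∀ t : ℕ, ∑ τ ∈ Finset.range t, a τ ≤ K * t) :
    Tendsto (fun t : ℕ => a t / t) atTop (nhds 0) := by
  have hK : 0 ≤ K := by
    have := hsum 1
    simp only [Finset.sum_range_one, Nat.cast_one, mul_one] at this
    exact (ha 0).trans this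
  have h1 : ∀ t k : ℕ, a t ≤ a (t + k) + k * b := by
    intro t k
    induction k with
    | zero => simp
    | succ k ih =>
      have := hstep (t + k)
      rw [← add_assoc]
      push_cast
      linarith
  have h2 : ∀ t n : ℕ, n * a t ≤ K * (t + n) + n * (n * b) := by
    intro t n
    have h3 : ∑ _k ∈ Finset.range n, a t ≤ ∑ k ∈ Finset.range n, (a (t + k) + n * b) := by
      refine Finset.sum_le_sum fun k hk => (h1 t k).trans ?_
      have : (k : ℝ) ≤ n := by exact_mod_cast (Finset.mem_range.1 hk).le
      have := mul_le_mul_of_nonneg_right this hb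
      linarith
    have h4 := hsum (t + n)
    rw [Finset.sum_range_add] at h4
    have h5 : 0 ≤ ∑ τ ∈ Finset.range t, a τ := Finset.sum_nonneg fun i _ => ha i
    simp only [Finset.sum_const, Finset.card_range, nsmul_eq_mul, Finset.sum_add_distrib] at h3
    push_cast at h4
    linarith
  have h3 : ∀ t : ℕ, 1 ≤ t → a t / t ≤ (2 * (2 * K + b)) / √t := by
    intro t ht
    have ht' : (1 : ℝ) ≤ t := by exact_mod_cast ht
    have hs : (1 : ℝ) ≤ √t := Real.one_le_sqrt.2 ht'
    -- The added 1 gives `t ≤ n²`, and `n ≤ 2√t` holds because `t ≥ 1`.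
    set n := Nat.sqrt t + 1 with hn
    have hn1 : (1 : ℝ) ≤ n := by exact_mod_cast Nat.succ_le_succ (Nat.zero_le _)
    have hn2 : (t : ℝ) ≤ n * n := by exact_mod_cast (Nat.lt_succ_sqrt t).le
    have hn3 : (n : ℝ) ≤ 2 * √t := by
      have := Real.nat_sqrt_le_real_sqrt (a := t)
      rw [hn]
      push_cast
      linarith
    have h4 : a t ≤ (2 * K + b) * n := by
      have h5 : n * a t ≤ n * ((2 * K + b) * n) := by
        have h6 := mul_le_mul_of_nonneg_left hn2 hK
        have h7 : K * n ≤ K * (n * n) :=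
          mul_le_mul_of_nonneg_left (le_mul_of_one_le_left (by linarith) hn1) hK
        nlinarith [h2 t n]
      exact le_of_mul_le_mul_left h5 (by linarith)
    have h8 : a t ≤ 2 * (2 * K + b) * √t := by
      have := mul_le_mul_of_nonneg_left hn3 (by positivity : 0 ≤ 2 * K + b)
      linarith
    rw [div_le_div_iff₀ (by linarith) (by linarith)]
    calc a t * √t ≤ 2 * (2 * K + b) * √t * √t := mul_le_mul_of_nonneg_right h8 (by linarith)
      _ = 2 * (2 * K + b) * t := by rw [mul_assoc, Real.mul_self_sqrt (by linarith)]
  refine squeeze_zero' (.of_forall fun t => div_nonneg (ha t) (Nat.cast_nonneg t))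
    ((eventually_ge_atTop 1).mono h3) ?_
  exact tendsto_const_nhds.div_atTop (Real.tendsto_sqrt_atTop.comp tendsto_natCast_atTop_atTop)

/-! ### Averages over slots, and the mean length of a renewal interval. -/

namespace Network

section

variable {N Z W A : Type*} {M : ℕ}
  [MeasurableSpace Z] [MeasurableSpace W] [MeasurableSpace A]
  {S : Network N Z W A M} {r : RenewalRule Z W A}

theorem Policy.integrable_level (p : S.Policy) (i : N ⊕ Fin M) (t : ℕ) :
    Integrable (S.level i t) p.prob := by
  refine Integrable.of_bound (measurable_level (X := id) i fun s _ =>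
    measurable_pi_apply s).aestronglyMeasurable (t * S.stepMax i) ?_
  filter_upwards [p.ae_feasible] with path h
  rw [Real.norm_eq_abs, abs_of_nonneg (level_nonneg h i t)]
  exact level_le h i t

theorem Policy.integrable_increment (p : S.Policy) (i : N ⊕ Fin M) (t : ℕ) :
    Integrable (fun path => S.increment i (path t)) p.prob := by
  refine Integrable.of_bound ((measurable_increment S i).comp
    (measurable_pi_apply t)).aestronglyMeasurable (S.stepMax i) ?_
  filter_upwards [p.ae_feasible] with path h
  exact abs_increment_le (h t) i

theorem Policy.integral_level_le_succ (p : S.Policy) (i : N ⊕ Fin M) (t : ℕ) :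
    ∫ path, S.level i t path ∂p.prob ≤ ∫ path, S.level i (t + 1) path ∂p.prob + S.stepMax i := by
  have h : ∫ path, (S.level i (t + 1) path + S.stepMax i) ∂p.prob
      = ∫ path, S.level i (t + 1) path ∂p.prob + S.stepMax i := by
    rw [integral_add (p.integrable_level i (t + 1)) (integrable_const _)]
    simp
  rw [← h]
  refine integral_mono_ae (p.integrable_level i t)
    ((p.integrable_level i (t + 1)).add (integrable_const _)) ?_
  filter_upwards [p.ae_feasible] with path hpath
  have := (neg_le_abs _).trans (abs_level_add_sub_le hpath i t 1)
  push_cast at this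
  linarith

/-- A sublinear mean virtual queue makes the time average constraint hold. -/
theorem Policy.timeAverage_le (p : S.Policy) (m : Fin M)
    (h : Tendsto (fun t : ℕ => (∫ path, S.level (.inr m) t path ∂p.prob) / t) atTop (nhds 0)) :
    p.timeAverage m.succ ≤ (S.target m : EReal) := by
  have h1 : ∀ t : ℕ, ∑ τ ∈ Finset.range t, ∫ path, S.penalty m.succ (path τ) ∂p.prob
      ≤ t * S.target m + ∫ path, S.level (.inr m) t path ∂p.prob := by
    intro t
    have h2 : ∀ τ, ∫ path, S.penalty m.succ (path τ) ∂p.prob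
        = ∫ path, S.increment (.inr m) (path τ) ∂p.prob + S.target m := by
      intro τ
      have : (fun path : SamplePath Z W A => S.penalty m.succ (path τ))
          = fun path => S.increment (.inr m) (path τ) + S.target m := by
        ext path
        simp [increment]
      rw [this, integral_add (p.integrable_increment (.inr m) τ) (integrable_const _)]
      simp
    simp only [h2, Finset.sum_add_distrib, Finset.sum_const, Finset.card_range, nsmul_eq_mul]
    rw [← integral_finsetSum _ fun τ _ => p.integrable_increment (.inr m) τ]
    have h3 := integral_mono (μ := p.prob)
      (integrable_finsetSum (Finset.range t) fun τ _ => p.integrable_increment (.inr m) τ)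
      (p.integrable_level (.inr m) t) fun path => sum_increment_le_level path m t
    linarith
  have h4 : Tendsto (fun t : ℕ => S.target m + (∫ path, S.level (.inr m) t path ∂p.prob) / t)
      atTop (nhds (S.target m)) := by
    simpa using tendsto_const_nhds.add h
  rw [← (EReal.tendsto_coe.2 h4).limsup_eq]
  refine limsup_le_limsup ?_
  filter_upwards [eventually_ge_atTop 1] with t ht
  have ht' : (0 : ℝ) < t := by exact_mod_cast ht
  rw [EReal.coe_le_coe_iff, div_le_iff₀ ht', add_mul, div_mul_cancel₀ _ ht'.ne']
  linarith [h1 t]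

theorem Policy.stronglyStable_level (p : S.Policy) (i : N ⊕ Fin M) {K : ℝ}
    (h : ∀ t : ℕ, ∑ τ ∈ Finset.range t, ∫ path, S.level i τ path ∂p.prob ≤ K * t) :
    p.StronglyStable (S.level i) := by
  refine (limsup_le_of_le (a := ENNReal.ofReal K)
    (h := .of_forall fun t => ENNReal.div_le_of_le_mul ?_)).trans_lt ENNReal.ofReal_lt_top
  have h0 : ∀ τ, 0 ≤ᵐ[p.prob] S.level i τ := fun τ => by
    filter_upwards [p.ae_feasible] with path hpath
    exact level_nonneg hpath i τ
  simp only [← fun τ => ofReal_integral_eq_lintegral_ofReal (p.integrable_level i τ) (h0 τ)]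
  rw [← ENNReal.ofReal_sum_of_nonneg fun τ _ => integral_nonneg_of_ae (h0 τ),
    ← ENNReal.ofReal_natCast, ← ENNReal.ofReal_mul' (Nat.cast_nonneg t)]
  exact ENNReal.ofReal_le_ofReal (h t)

theorem Policy.tsum_noForced (p : S.Policy) :
    ∑' k : ℕ, p.prob {path | ∀ s < k, (path s).1.2.2 = false} = ENNReal.ofReal (1 / S.phi) := by
  have h : (0 : ℝ) < S.phi := S.phi_pos
  simp only [p.prob_noForced]
  rw [ENNReal.tsum_geometric, ← ENNReal.ofReal_one, ← ENNReal.ofReal_sub _ (sub_nonneg.2 S.phi.2.2),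
    sub_sub_cancel, one_div, ENNReal.ofReal_inv_of_pos h]

theorem Regular.noForced_of_lt_renewalLength {path : SamplePath Z W A} (hpath : S.Regular r path)
    (hforced : ∀ t, (path t).1.2.2 = true → S.IsRenewal r path (t + 1)) {k : ℕ}
    (hk : k < S.renewalLength r 0 path) : ∀ s < k, (path s).1.2.2 = false := by
  intro s hs
  by_contra hne
  have h1 := renewalTime_succ_le (g := 0) (hforced s (by simpa using hne)) (by simp)
  rw [hpath.renewalTime_succ, renewalTime_zero] at h1
  omega

end

section

variable {N Z W A : Type*} {M : ℕ}
  [MeasurableSpace Z] [MeasurableSingletonClass Z] [MeasurableSpace W] [MeasurableSpace A]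
  {S : Network N Z W A M} {r : RenewalRule Z W A}

theorem Policy.meanLength_eq_tsum (p : S.Policy) (r : RenewalRule Z W A) :
    S.meanLength r p = (∑' k : ℕ, p.prob {path | k < S.renewalLength r 0 path}).toReal := by
  have hm := measurable_renewalLength S r 0
  have h1 : ∀ n : ℕ, (n : ℝ≥0∞) = ∑' k : ℕ, if k < n then 1 else 0 := by
    intro n
    rw [tsum_eq_sum (s := Finset.range n) fun k hk => if_neg (by simpa using hk)]
    rw [Finset.sum_congr rfl fun k hk => if_pos (Finset.mem_range.1 hk)]
    simp
  have hms : ∀ k : ℕ, MeasurableSet {path | k < S.renewalLength r 0 path} := fun k =>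
    hm measurableSet_Ioi
  unfold meanLength
  rw [integral_eq_lintegral_of_nonneg_ae (.of_forall fun path => Nat.cast_nonneg _)
    (measurable_from_top.comp hm).aestronglyMeasurable]
  simp only [ENNReal.ofReal_natCast]
  congr 1
  simp only [fun path => h1 (S.renewalLength r 0 path)]
  rw [lintegral_tsum fun k =>
    (Measurable.ite (hms k) measurable_const measurable_const).aemeasurable]
  refine tsum_congr fun k => ?_
  rw [← lintegral_indicator_one (hms k)]
  refine lintegral_congr fun path => ?_
  simp [Set.indicator_apply]

namespace RenewalRequirements

/-- If the mean backlogs at the renewals are bounded on average, then so are those at all slots. -/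
theorem exists_sum_integral_level_le (hr : S.RenewalRequirements r) (p : S.Policy)
    (i : N ⊕ Fin M) {K : ℝ}
    (h : ∀ G : ℕ, ∑ g ∈ Finset.range G, ∫ path, S.level i (S.renewalTime r g path) path ∂p.prob
      ≤ G * K) :
    ∃ K' : ℝ, ∀ t : ℕ, ∑ τ ∈ Finset.range t, ∫ path, S.level i τ path ∂p.prob ≤ K' * t := by
  obtain ⟨m₁, m₂, hm₁, hm₂, hm⟩ := hr.exists_moment_bounds
  refine ⟨m₁ * K + S.stepMax i * m₂, fun t => ?_⟩
  have hmul : ∀ g, Integrable (fun path => S.level i (S.renewalTime r g path) path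
      * (S.renewalLength r g path : ℝ)) p.prob := fun g =>
    (hr.memLp_level p i g).integrable_mul (hm p g).1
  have hsq : ∀ g, Integrable (fun path => S.stepMax i * (S.renewalLength r g path : ℝ) ^ 2)
      p.prob := fun g => (hm p g).1.integrable_sq.const_mul _
  -- T_g may depend on the backlog, but its mean given Θ(t_g) is at most `m₁`, so the backlog
  -- factors out.
  have h1 : ∀ g, ∫ path, S.level i (S.renewalTime r g path) path
      * (S.renewalLength r g path : ℝ) ∂p.prob
      ≤ m₁ * ∫ path, S.level i (S.renewalTime r g path) path ∂p.prob := by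
    intro g
    obtain ⟨h2, h3⟩ := hr.integral_level_mul_condExp p i g (hm p g).1
    rw [← h3, ← integral_const_mul]
    refine integral_mono_ae h2
      (((hr.memLp_level p i g).integrable (by norm_num)).const_mul _) ?_
    filter_upwards [(hm p g).2.1, p.ae_feasible] with path h4 hpath
    rw [mul_comm]
    exact mul_le_mul_of_nonneg_right h4 (level_nonneg hpath i _)
  have h5 : ∀ g, ∫ path, S.stepMax i * (S.renewalLength r g path : ℝ) ^ 2 ∂p.prob
      ≤ S.stepMax i * m₂ := by
    intro g
    rw [integral_const_mul]
    refine mul_le_mul_of_nonneg_left ?_ (S.stepMax_nonneg i)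
    rw [← integral_condExp (backlogSigma_le S r g)]
    refine (integral_mono_ae integrable_condExp (integrable_const _) (hm p g).2.2).trans_eq ?_
    simp
  rw [← integral_finsetSum _ fun τ _ => p.integrable_level i τ]
  calc ∫ path, ∑ τ ∈ Finset.range t, S.level i τ path ∂p.prob
      ≤ ∫ path, ∑ g ∈ Finset.range t, (S.level i (S.renewalTime r g path) path
          * (S.renewalLength r g path : ℝ)
          + S.stepMax i * (S.renewalLength r g path : ℝ) ^ 2) ∂p.prob := by
        refine integral_mono_ae (integrable_finsetSum _ fun τ _ => p.integrable_level i τ)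
          (integrable_finsetSum _ fun g _ => (hmul g).add (hsq g)) ?_
        filter_upwards [hr.ae_regular p] with path hpath
        exact hpath.sum_level_le i t
    _ = ∑ g ∈ Finset.range t, (∫ path, S.level i (S.renewalTime r g path) path
          * (S.renewalLength r g path : ℝ) ∂p.prob
          + ∫ path, S.stepMax i * (S.renewalLength r g path : ℝ) ^ 2 ∂p.prob) := by
        refine (integral_finsetSum _ fun g _ => (hmul g).add (hsq g)).trans ?_
        exact Finset.sum_congr rfl fun g _ => integral_add (hmul g) (hsq g)
    _ ≤ ∑ g ∈ Finset.range t, (m₁ * ∫ path, S.level i (S.renewalTime r g path) path ∂p.prob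
          + S.stepMax i * m₂) := Finset.sum_le_sum fun g _ => add_le_add (h1 g) (h5 g)
    _ ≤ (m₁ * K + S.stepMax i * m₂) * t := by
        rw [Finset.sum_add_distrib, ← Finset.mul_sum, Finset.sum_const, Finset.card_range,
          nsmul_eq_mul]
        have := mul_le_mul_of_nonneg_left (h t) hm₁
        linarith

variable (hr : S.RenewalRequirements r)
include hr

theorem one_le_meanLength (p : S.Policy) : 1 ≤ S.meanLength r p := by
  have h : ∫ _path, (1 : ℝ) ∂p.prob ≤ S.meanLength r p := by
    refine integral_mono_ae (integrable_const 1)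
      ((hr.exists_moment_bounds.choose_spec.choose_spec.2.2 p 0).1.integrable (by norm_num)) ?_
    filter_upwards [hr.ae_regular p] with path hpath
    exact_mod_cast hpath.one_le_renewalLength 0
  simpa using h

/-- If all forced renewals are renewals, then the mean renewal interval is at most `1 / φ`. -/
theorem meanLength_le (p : S.Policy)
    (hforced : ∀ᵐ path ∂p.prob, ∀ t, (path t).1.2.2 = true → S.IsRenewal r path (t + 1)) :
    S.meanLength r p ≤ 1 / S.phi := by
  have h : (0 : ℝ) < S.phi := S.phi_pos
  rw [p.meanLength_eq_tsum r]
  refine ENNReal.toReal_le_of_le_ofReal (by positivity) ?_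
  rw [← p.tsum_noForced]
  refine ENNReal.tsum_le_tsum fun k => measure_mono_ae ?_
  filter_upwards [hforced, hr.ae_regular p] with path h1 hpath hk
  exact hpath.noForced_of_lt_renewalLength h1 hk

/-- If the renewals are the slots after forced renewals, then the mean renewal interval
is `1 / φ`. -/
theorem meanLength_eq_one_div (p : S.Policy)
    (hforced : ∀ᵐ path ∂p.prob, ∀ t, (path t).1.2.2 = true ↔ S.IsRenewal r path (t + 1)) :
    S.meanLength r p = 1 / S.phi := by
  have h : (0 : ℝ) < S.phi := S.phi_pos
  rw [p.meanLength_eq_tsum r, ← ENNReal.toReal_ofReal (by positivity : (0 : ℝ) ≤ 1 / S.phi),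
    ← p.tsum_noForced]
  congr 1
  refine tsum_congr fun k => measure_congr ?_
  filter_upwards [hforced, hr.ae_regular p] with path h1 hpath
  refine propext ⟨fun hk => hpath.noForced_of_lt_renewalLength (fun t => (h1 t).1) hk,
    fun hk => ?_⟩
  change k < S.renewalLength r 0 path
  -- If T ≤ k, then slot T is a renewal, so slot T - 1 < k had a forced one.
  by_contra hle
  have h2 := hpath.isRenewal_renewalTime 1
  rw [hpath.renewalTime_succ, renewalTime_zero, zero_add] at h2
  obtain ⟨t, ht⟩ := Nat.exists_eq_succ_of_ne_zero
    (Nat.one_le_iff_ne_zero.1 (hpath.one_le_renewalLength 0))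
  rw [ht] at h2
  have h3 := hk t (by omega)
  rw [(h1 t).2 h2] at h3
  exact absurd h3 (by simp)

end RenewalRequirements

omit [MeasurableSingletonClass Z] in
theorem isRenewal_typeOne {path : SamplePath Z W A} {t : ℕ}
    (h : (path (t + 1)).1.1 = S.zero) : S.IsRenewal RenewalRule.typeOne path (t + 1) :=
  Or.inr ⟨h, trivial⟩

omit [MeasurableSingletonClass Z] in
theorem isRenewal_typeTwo_iff {path : SamplePath Z W A} {t : ℕ}
    (h : (path t).1.2.2 = true → (path (t + 1)).1.1 = S.zero) :
    (path t).1.2.2 = true ↔ S.IsRenewal RenewalRule.typeTwo path (t + 1) := by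
  constructor
  · exact fun h1 => Or.inr ⟨h h1, ⟨t, t.lt_succ_self⟩, rfl, h1⟩
  · rintro (h1 | ⟨-, i, hi, h1⟩)
    · omega
    · have : (i : ℕ) = t := by omega
      rw [← this]
      exact h1

end

end Network

/-! ### Assembly of the theorem. -/

theorem mainTheorem1 {N Z W A : Type*} [Fintype N] {M : ℕ}
    [Countable Z] [MeasurableSpace Z] [MeasurableSingletonClass Z]
    [MeasurableSpace W] [MeasurableSpace A]
    (S : Network N Z W A M) (r : RenewalRule Z W A) (hr : S.RenewalRequirements r)
    (ε : ℝ) (hε : 0 < ε) (pStar : S.StationaryPolicy) (hslack : S.HasSlack r pStar ε)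
    (p : S.Policy) (C δ : ℝ) (hC : 0 ≤ C) (hδ : 0 ≤ δ)
    (happrox : S.ApproxShortestPath r p C δ)
    (hδε : δ < ε * S.meanLength r pStar.toPolicy)
    (sigmaSq : ℝ) (hsigma : S.IsSlotBound p sigmaSq) :
    (∀ n, p.StronglyStable (S.queue n)) ∧
    (∀ m, p.StronglyStable (S.virtualQueue m)) ∧
    (∀ m : Fin M, p.timeAverage m.succ ≤ (S.target m : EReal)) ∧
    (∀ g n, Integrable (fun path => (S.backlog r g path).1 n) p.prob) ∧
    (∀ g m, Integrable (fun path => (S.backlog r g path).2 m) p.prob) ∧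
    (∀ G : ℕ, 0 < G →
      (1 / (G : ℝ)) * ∑ g ∈ Finset.range G,
          (∑ n, ∫ path, (S.backlog r g path).1 n ∂p.prob
            + ∑ m, ∫ path, (S.backlog r g path).2 m ∂p.prob)
        ≤ (S.driftConst r p sigmaSq + C) / (ε * S.meanLength r pStar.toPolicy - δ)) ∧
    (r = RenewalRule.typeOne →
      1 ≤ S.meanLength r pStar.toPolicy ∧ S.meanLength r pStar.toPolicy ≤ 1 / (S.phi : ℝ)) ∧
    (r = RenewalRule.typeTwo →
      S.meanLength r pStar.toPolicy = 1 / (S.phi : ℝ)) := by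
  have hsum := hr.sum_integral_level_le hslack hδ hε hδε happrox hsigma
  have hnonneg : ∀ g i, 0 ≤ ∫ path, S.level i (S.renewalTime r g path) path ∂p.prob :=
    fun g i => integral_nonneg_of_ae <| by
      filter_upwards [p.ae_feasible] with path hpath
      exact Network.level_nonneg hpath i _
  have hslots : ∀ i, ∃ K : ℝ, ∀ t : ℕ,
      ∑ τ ∈ Finset.range t, ∫ path, S.level i τ path ∂p.prob ≤ K * t := fun i =>
    -- The bound on the total backlog passes to a single queue because all the mean backlogs are
    -- nonnegative.
    hr.exists_sum_integral_level_le p i fun G =>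
      (Finset.sum_le_sum fun g _ =>
        Finset.single_le_sum (fun j _ => hnonneg g j) (Finset.mem_univ i)).trans (hsum G)
  have hstable : ∀ i, p.StronglyStable (S.level i) := fun i =>
    p.stronglyStable_level i (hslots i).choose_spec
  refine ⟨fun n => hstable (.inl n), fun m => hstable (.inr m), fun m => ?_,
    fun g n => hr.integrable_level p (.inl n) g, fun g m => hr.integrable_level p (.inr m) g,
    fun G hG => ?_, ?_, ?_⟩
  · refine p.timeAverage_le m (tendsto_div_atTop_of_sum_le (fun t => ?_)
      (p.integral_level_le_succ (.inr m)) (S.stepMax_nonneg _) (hslots (.inr m)).choose_spec)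
    exact integral_nonneg_of_ae (p.ae_feasible.mono fun path hpath =>
      Network.level_nonneg hpath _ _)
  · have hG' : (0 : ℝ) < G := by exact_mod_cast hG
    have h := hsum G
    simp only [Fintype.sum_sum_type] at h
    rw [one_div, inv_mul_le_iff₀ hG']
    exact h
  · rintro rfl
    refine ⟨hr.one_le_meanLength _, hr.meanLength_le _ ?_⟩
    filter_upwards [pStar.toPolicy.ae_forced] with path hpath t ht
    exact Network.isRenewal_typeOne (hpath t ht)
  · rintro rfl
    refine hr.meanLength_eq_one_div _ ?_
    filter_upwards [pStar.toPolicy.ae_forced] with path hpath t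
    exact Network.isRenewal_typeTwo_iff (hpath t)
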